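/- Let $\Lambda=\mathbb T^d=\mathbb R^d/\mathbb Z^d$ with $d\in\{2,3\}$, fix $\kappa>0$, and set $\lambda_k=4\pi^2|k|^2+\kappa$ for $k\in\mathbb Z^d$, where $|\cdot|$ is the Euclidean norm. Let $\mu=\bigotimes_{k\in\mathbb Z^d}\mu_k$ on $\mathbb C^{\mathbb Z^d}$ (with the product sigma-algebra), where $\mu_k=\frac1\pi e^{-|z|^2}\,dz$ is the standard complex Gaussian measure on $\mathbb C$. For $K\in\mathbb N=\{0,1,2,\dots\}$ and $\omega\in\mathbb C^{\mathbb Z^d}$ let $$\phi_{[K]}(x)=\sum_{|k|\le K}\frac{\omega_k}{\sqrt{\lambda_k}}\,e^{2\pi i k\cdot x},\qquad \varrho_{[K]}=\int |\phi_{[K]}(0)|^2\,d\mu,$$ and, for $w\in L^1(\Lambda)$, let $$W_{[K]}=\frac12\int_\Lambda\int_\Lambda\big(|\phi_{[K]}(x)|^2-\varrho_{[K]}\big)\,w(x-y)\,\big(|\phi_{[K]}(y)|^2-\varrho_{[K]}\big)\,dx\,dy .$$ Let $\hat w(k)=\int_\Lambda w(x)e^{-2\pi i k\cdot x}\,dx$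 and $\langle k\rangle=(1+|k|^2)^{1/2}$. We say that $w$ is of positive type if $\hat w(k)\ge 0$ for all $k\in\mathbb Z^d$. Assume that $w:\Lambda\to\mathbb C$ is even and satisfies one of the following. (i) ($w$ is $d$-admissible.) $w\in L^p(\Lambda)$ for some $p\in(1,\infty)$ if $d=2$, respectively for some $p\in(3,\infty)$ if $d=3$; $w$ is of positive type; and $w\notin L^\infty(\Lambda)$. (ii) ($d=2$ and $w$ is endpoint-admissible.) $w\in L^1(\Lambda)$; $w$ is of positive type; $w\ge 0$ pointwise; there exist $\epsilon>0$ and $L>0$ such that $\hat w(k)\le L\langle k\rangle^{-\epsilon}$ for all $k\in\mathbb Z^2$; and $w\notin L^\infty(\Lambda)$. Then $(W_{[K]})_{K\in\mathbb N}$ is a Cauchy sequence in $\bigcap_{m\ge1}L^m(\mu)$: for every $m\in[1,\infty)$, each $W_{[K]}$ belongs to $L^m(\mu)$ and the sequence is Cauchy in $L^m(\mu)$. Consequently there is a $\mu$-almost everywhere unique $W\in\bigcap_{m\ge1}L^m(\mu)$, the Wick-ordered interaction, such that $W_{[K]}\to W$ in $L^m(\mu)$ for every $m\in[1,\infty)$.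 -/

import Mathlib

open MeasureTheory Filter Topology
open scoped ENNReal

noncomputable section

namespace WickGibbs

/-- Points of the torus `Λ = ℝᵈ / ℤᵈ`. -/
abbrev Torus (d : ℕ) : Type := UnitAddTorus (Fin d)

/-- Lebesgue measure on the torus, of total mass one. -/
abbrev torusMeasure (d : ℕ) : Measure (Torus d) :=
  Measure.pi fun _ => AddCircle.haarAddCircle

/-- The squared Euclidean norm `|k|²` of a frequency `k ∈ ℤᵈ`. -/
def freqNormSq {d : ℕ} (k : Fin d → ℤ) : ℝ := ∑ i, (k i : ℝ) ^ 2

/-- The Japanese bracket `⟨k⟩ = (1 + |k|²)^{1/2}`. -/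
def japaneseBracket {d : ℕ} (k : Fin d → ℤ) : ℝ := √(1 + freqNormSq k)

/-- The eigenvalues `λ_k = 4π²|k|² + κ` of the one-body Hamiltonian `-Δ + κ` on the torus. -/
def eigenvalue (κ : ℝ) {d : ℕ} (k : Fin d → ℤ) : ℝ := 4 * Real.pi ^ 2 * freqNormSq k + κ

/-- The finite set of frequencies `k ∈ ℤᵈ` with Euclidean norm `|k| ≤ K`. -/
def freqBall (d K : ℕ) : Finset (Fin d → ℤ) :=
  {k ∈ Fintype.piFinset fun _ => Finset.Icc (-(K : ℤ)) K | ∑ i, k i ^ 2 ≤ (K : ℤ) ^ 2}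

theorem mem_freqBall {d K : ℕ} {k : Fin d → ℤ} : k ∈ freqBall d K ↔ √(freqNormSq k) ≤ K := by
  have h : √(freqNormSq k) ≤ K ↔ ∑ i, k i ^ 2 ≤ (K : ℤ) ^ 2 := by
    rw [Real.sqrt_le_left (by positivity), freqNormSq]
    exact_mod_cast Iff.rfl
  rw [h, freqBall, Finset.mem_filter, and_iff_right_iff_imp, Fintype.mem_piFinset]
  intro hk i
  rw [Finset.mem_Icc]
  refine abs_le.mp (abs_le_of_sq_le_sq ?_ (by positivity))
  exact (Finset.single_le_sum (f := fun i => k i ^ 2) (fun j _ => sq_nonneg (k j))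
    (Finset.mem_univ i)).trans hk

/-- The standard complex Gaussian law `π⁻¹ e^{-|z|²} dz` on `ℂ`. -/
def complexGaussian : Measure ℂ :=
  volume.withDensity fun z => ENNReal.ofReal (Real.pi⁻¹ * Real.exp (-‖z‖ ^ 2))

instance : IsProbabilityMeasure complexGaussian := by
  have h := GaussianFourier.integral_rexp_neg_mul_sq_norm (V := ℂ) (b := 1) one_pos
  have hi : Integrable fun z : ℂ => Real.pi⁻¹ * Real.exp (-‖z‖ ^ 2) := by
    refine Integrable.const_mul ?_ _
    refine Integrable.of_integral_ne_zero ?_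
    simp only [neg_mul, one_mul] at h
    rw [h]
    positivity
  constructor
  rw [complexGaussian, withDensity_apply _ MeasurableSet.univ, Measure.restrict_univ,
    ← ofReal_integral_eq_lintegral_ofReal hi (ae_of_all _ fun z => by positivity),
    integral_const_mul]
  simp only [neg_mul, one_mul] at h
  rw [h]
  simp [Complex.finrank_real_complex, Real.pi_ne_zero]

/-- The law of a family of independent standard complex Gaussians indexed by `ℤᵈ`, on the product
space `ℂ^{ℤᵈ}` with the product sigma-algebra. -/
def freeFieldMeasure (d : ℕ) : Measure ((Fin d → ℤ) → ℂ) :=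
  Measure.infinitePi fun _ => complexGaussian

/-- The truncated classical free field
`φ_{[K]}(x) = ∑_{|k| ≤ K} ω_k / √λ_k · e^{2πi k·x}`. -/
def truncField (κ : ℝ) {d : ℕ} (K : ℕ) (ω : (Fin d → ℤ) → ℂ) (x : Torus d) : ℂ :=
  ∑ k ∈ freqBall d K, ω k / (√(eigenvalue κ k) : ℂ) * UnitAddTorus.mFourier k x

/-- The density `ϱ_{[K]} = ∫ |φ_{[K]}(0)|² dμ`. -/
def truncDensity (κ : ℝ) (d K : ℕ) : ℝ :=
  ∫ ω, ‖truncField κ K ω (0 : Torus d)‖ ^ 2 ∂(freeFieldMeasure d)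

/-- The truncated Wick-ordered classical interaction
`W_{[K]} = ½ ∫∫ (|φ_{[K]}(x)|² - ϱ_{[K]}) w(x - y) (|φ_{[K]}(y)|² - ϱ_{[K]}) dx dy`. -/
def truncInteraction (κ : ℝ) {d : ℕ} (w : Torus d → ℂ) (K : ℕ) (ω : (Fin d → ℤ) → ℂ) : ℂ :=
  1 / 2 * ∫ x, ∫ y,
    ((‖truncField κ K ω x‖ ^ 2 - truncDensity κ d K : ℝ) : ℂ) * w (x - y) *
      ((‖truncField κ K ω y‖ ^ 2 - truncDensity κ d K : ℝ) : ℂ)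
    ∂(torusMeasure d) ∂(torusMeasure d)

/-- `w` is even, as an element of a Lebesgue space. -/
def IsEven {d : ℕ} (w : Torus d → ℂ) : Prop := ∀ᵐ x ∂(torusMeasure d), w (-x) = w x

/-- `w` is real and nonnegative, as an element of a Lebesgue space. -/
def IsNonneg {d : ℕ} (w : Torus d → ℂ) : Prop :=
  ∀ᵐ x ∂(torusMeasure d), 0 ≤ (w x).re ∧ (w x).im = 0

/-- `w` is of positive type: all its Fourier coefficients
`ŵ(k) = ∫ w(x) e^{-2πi k·x} dx` are real and nonnegative. -/
def IsPositiveType {d : ℕ} (w : Torus d → ℂ) : Prop :=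
  ∀ k : Fin d → ℤ, 0 ≤ (UnitAddTorus.mFourierCoeff w k).re ∧
    (UnitAddTorus.mFourierCoeff w k).im = 0

/-- The range of integrability exponents allowed in dimension `d`: `[1,∞)`, `(1,∞)`, `(3,∞)` for
`d = 1, 2, 3`. -/
def exponentRange : ℕ → Set ℝ
  | 1 => Set.Ici 1
  | 2 => Set.Ioi 1
  | 3 => Set.Ioi 3
  | _ => ∅

/-- `d`-admissible interaction potentials (`d = 1, 2, 3`). -/
structure IsAdmissible {d : ℕ} (w : Torus d → ℂ) : Prop where
  even : IsEven w
  memLp : ∃ p ∈ exponentRange d, MemLp w (ENNReal.ofReal p) (torusMeasure d)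
  nonneg : d = 1 → IsNonneg w
  positiveType : d = 2 ∨ d = 3 → IsPositiveType w
  unbounded : ¬ MemLp w ∞ (torusMeasure d)

/-- Endpoint-admissible interaction potentials (`d = 2`). -/
structure IsEndpointAdmissible {d : ℕ} (w : Torus d → ℂ) : Prop where
  dim : d = 2
  even : IsEven w
  memLp : MemLp w 1 (torusMeasure d)
  positiveType : IsPositiveType w
  nonneg : IsNonneg w
  decay : ∃ ε : ℝ, 0 < ε ∧ ∃ L : ℝ, 0 < L ∧ ∀ k : Fin d → ℤ,
    (UnitAddTorus.mFourierCoeff w k).re ≤ L * japaneseBracket k ^ (-ε)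
  unbounded : ¬ MemLp w ∞ (torusMeasure d)

end WickGibbs

end

/-!
The truncated interaction is diagonal in Fourier space. If `A_q` denotes the `q`-th Fourier
coefficient of the Wick-ordered density `|φ_{[K]}|² - ϱ_{[K]}`, a sum of the variables
`(ω_k ω̄_l - δ_{kl}) / √(λ_k λ_l)` over the pairs with `k - l = q`, then
`W_{[K]} = ½ ∑_q ŵ(-q) |A_q|²` (`truncInteraction_eq_sum`). Since `ŵ ≥ 0`, there are no cancellations
to exploit: the expectation of `W_{[K]}` is already a series of nonnegative terms, and the triangle
inequality in `Lⁿ(μ)` bounds every moment by a series of the same kind. Two facts carry this out.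

* Moments of `A_q` are controlled by its variance (`exists_eLpNorm_densityMode_le`):
  `‖A_q‖_{L^{2n}} ≤ C_n (∑_{k-l=q} 1 / (λ_k λ_l))^{1/2}`. Full hypercontractivity is not needed:
  for fixed `q`, the pairs `(k, k - q)` split into two classes within each of which the pairs are
  disjoint (`exists_coloring`), so that `A_q` is a sum of two sums of independent centred variables,
  to which the elementary inequality `exists_integral_norm_sum_pow_le` applies.
* The double series `∑_{k,l} ŵ(l - k) / (λ_k λ_l)`, formally `∫ w G²` with `G` the Green function of
  `-Δ + κ`, converges (`summable_potentialCoeff`). By a dyadic decomposition it is enough to have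
  `∑_{k ∈ A, l ∈ B} ŵ(l - k) ≤ C (|A| |B|)^θ` with `θ d < 2`. For `w ∈ Lᵖ` the left side is the
  integral of `w` against a product of two Dirichlet kernels, and Hölder's inequality gives
  `θ = 1/2 + 1/(2p)`; the condition `θ d < 2` is then exactly `p > 1` for `d = 2` and `p > 3` for
  `d = 3`. For endpoint-admissible `w` the same bound follows from the decay of `ŵ`.

Together with the Cauchy-Schwarz inequality in `q`, these bound `‖W_{[K]} - W_{[K']}‖_{Lⁿ}` by the
square root of the part of the double series over pairs in the `K`-ball that are not in the `K'`-ball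
(`exists_eLpNorm_truncInteraction_sub_le`), which is small for large `K` and `K'`.
-/

namespace WickGibbs

noncomputable section

open UnitAddTorus ComplexConjugate ProbabilityTheory

variable {d : ℕ}

/-! ### Characters of the torus and Dirichlet kernels -/

instance : (torusMeasure d).IsNegInvariant := by
  have : ∀ i : Fin d,
      ((fun _ => AddCircle.haarAddCircle) i : Measure UnitAddCircle).IsNegInvariant :=
    fun _ => inferInstance
  infer_instance

theorem norm_mFourier_apply (k : Fin d → ℤ) (x : Torus d) : ‖mFourier k x‖ = 1 := by
  simp only [mFourier, ContinuousMap.coe_mk, norm_prod, fourier_apply]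
  exact Finset.prod_eq_one fun i _ => Circle.norm_coe _

theorem mFourier_zero_apply (k : Fin d → ℤ) : mFourier k (0 : Torus d) = 1 := by
  simp [mFourier]

theorem mFourier_sub (k l : Fin d → ℤ) (x : Torus d) :
    mFourier (k - l) x = mFourier k x * conj (mFourier l x) := by
  rw [sub_eq_add_neg, mFourier_add, mFourier_neg]

theorem mFourier_apply_sub (k : Fin d → ℤ) (x y : Torus d) :
    mFourier k (x - y) = mFourier k x * conj (mFourier k y) := by
  simp only [mFourier, ContinuousMap.coe_mk, Pi.sub_apply, map_prod, ← Finset.prod_mul_distrib]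
  refine Finset.prod_congr rfl fun i _ => ?_
  rw [fourier_apply, fourier_apply, fourier_apply, smul_sub, sub_eq_add_neg,
    AddCircle.toCircle_add, AddCircle.toCircle_neg, Circle.coe_mul, Circle.coe_inv_eq_conj]

/-- Orthogonality of the characters of the torus. -/
theorem integral_mFourier (k : Fin d → ℤ) :
    ∫ x, mFourier k x ∂(torusMeasure d) = if k = 0 then 1 else 0 := by
  split_ifs with h
  · subst h
    simp [mFourier_zero]
  · obtain ⟨i, hi⟩ := Function.ne_iff.mp h
    simp only [mFourier, ContinuousMap.coe_mk]
    rw [integral_fintype_prod_eq_prod (fun i (y : UnitAddCircle) => fourier (k i) y)]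
    apply Finset.prod_eq_zero (Finset.mem_univ i)
    have := orthonormal_iff_ite.mp (orthonormal_fourier (T := 1)) 0 (k i)
    rw [if_neg (fun h => hi h.symm)] at this
    simpa only [ContinuousMap.inner_toLp, ← fourier_neg, ← fourier_add, neg_zero,
      add_zero, zero_add] using this

theorem integrable_of_continuous {f : Torus d → ℂ} (hf : Continuous f) :
    Integrable f (torusMeasure d) := by
  simpa using hf.continuousOn.integrableOn_compact (μ := torusMeasure d) isCompact_univ

/-- The Dirichlet kernel `∑_{k ∈ A} e^{2πi k·x}` of a finite set `A` of frequencies. -/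
def dirichletKernel (A : Finset (Fin d → ℤ)) (x : Torus d) : ℂ := ∑ k ∈ A, mFourier k x

theorem continuous_dirichletKernel (A : Finset (Fin d → ℤ)) :
    Continuous (dirichletKernel A) :=
  continuous_finsetSum _ fun k _ => (mFourier k).continuous

theorem norm_dirichletKernel_le (A : Finset (Fin d → ℤ)) (x : Torus d) :
    ‖dirichletKernel A x‖ ≤ A.card := by
  refine (norm_sum_le _ _).trans ?_
  simp [norm_mFourier_apply]

theorem dirichletKernel_mul_conj (A B : Finset (Fin d → ℤ)) (x : Torus d) :
    dirichletKernel A x * conj (dirichletKernel B x) =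
      ∑ k ∈ A, ∑ l ∈ B, mFourier (k - l) x := by
  simp only [dirichletKernel, map_sum, Finset.sum_mul_sum, mFourier_sub]

theorem integral_norm_sq_dirichletKernel (A : Finset (Fin d → ℤ)) :
    ∫ x, ‖dirichletKernel A x‖ ^ 2 ∂(torusMeasure d) = A.card := by
  have h : ∫ x, ((‖dirichletKernel A x‖ ^ 2 : ℝ) : ℂ) ∂(torusMeasure d) = A.card := by
    have : ∀ x, ((‖dirichletKernel A x‖ ^ 2 : ℝ) : ℂ) = ∑ k ∈ A, ∑ l ∈ A, mFourier (k - l) x := by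
      intro x
      rw [← dirichletKernel_mul_conj, Complex.mul_conj, Complex.normSq_eq_norm_sq]
    simp only [this]
    rw [integral_finsetSum _ fun k _ => integrable_finsetSum _ fun l _ =>
      integrable_of_continuous (mFourier _).continuous]
    simp_rw [integral_finsetSum _ fun l _ =>
      integrable_of_continuous (mFourier (_ - l)).continuous, integral_mFourier, sub_eq_zero]
    simp
  have h' := h
  rw [integral_complex_ofReal] at h'
  exact_mod_cast h'

/-- Interpolation between `‖D_A‖_∞ = |A|` and `‖D_A‖_2 = |A|^{1/2}`. -/
theorem eLpNorm_dirichletKernel_le (A : Finset (Fin d → ℤ)) {r : ℝ} (hr : 2 ≤ r) :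
    eLpNorm (dirichletKernel A) (ENNReal.ofReal r) (torusMeasure d) ≤
      ENNReal.ofReal ((A.card : ℝ) ^ (1 - 1 / r)) := by
  have hr0 : 0 < r := by linarith
  have hint : ∀ s : ℝ, 0 ≤ s →
      Integrable (fun x => ‖dirichletKernel A x‖ ^ s) (torusMeasure d) := by
    intro s hs
    refine Integrable.of_bound (C := (A.card : ℝ) ^ s) ?_ (ae_of_all _ fun x => ?_)
    · exact ((continuous_dirichletKernel A).norm.rpow_const
        fun _ => Or.inr hs).aestronglyMeasurable
    · rw [Real.norm_of_nonneg (by positivity)]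
      exact Real.rpow_le_rpow (norm_nonneg _) (norm_dirichletKernel_le A x) hs
  have hmem : MemLp (dirichletKernel A) (ENNReal.ofReal r) (torusMeasure d) :=
    MemLp.of_bound (continuous_dirichletKernel A).aestronglyMeasurable A.card
      (ae_of_all _ (norm_dirichletKernel_le A))
  rw [hmem.eLpNorm_eq_integral_rpow_norm (by simpa using hr0) ENNReal.ofReal_ne_top,
    ENNReal.toReal_ofReal hr0.le]
  refine ENNReal.ofReal_le_ofReal ?_
  have hle : ∫ x, ‖dirichletKernel A x‖ ^ r ∂(torusMeasure d) ≤
      (A.card : ℝ) ^ (r - 2) * A.card := by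
    have hsq := integral_norm_sq_dirichletKernel A
    rw [show (A.card : ℝ) ^ (r - 2) * A.card =
      ∫ x, (A.card : ℝ) ^ (r - 2) * ‖dirichletKernel A x‖ ^ 2 ∂(torusMeasure d) by
        rw [integral_const_mul, hsq]]
    refine integral_mono (hint r hr0.le)
      (((hint 2 (by norm_num)).const_mul ((A.card : ℝ) ^ (r - 2))).congr ?_) ?_
    · exact ae_of_all _ fun x => by simp
    · intro x
      rcases eq_or_ne (dirichletKernel A x) 0 with h0 | h0
      · simp [h0, Real.zero_rpow hr0.ne']
      have hpos : 0 < ‖dirichletKernel A x‖ := norm_pos_iff.mpr h0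
      have : ‖dirichletKernel A x‖ ^ r =
          ‖dirichletKernel A x‖ ^ (r - 2) * ‖dirichletKernel A x‖ ^ 2 := by
        rw [← Real.rpow_natCast, ← Real.rpow_add hpos]
        norm_num
      simp only [this]
      gcongr
      exact norm_dirichletKernel_le A x
  rcases Nat.eq_zero_or_pos A.card with h0 | h0
  · rw [h0] at hle ⊢
    have : ∫ x, ‖dirichletKernel A x‖ ^ r ∂(torusMeasure d) = 0 :=
      le_antisymm (by simpa using hle) (integral_nonneg fun x => by positivity)
    rw [this, Real.zero_rpow (by positivity)]
    positivity
  have hc : (0 : ℝ) < A.card := by exact_mod_cast h0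
  calc (∫ x, ‖dirichletKernel A x‖ ^ r ∂(torusMeasure d)) ^ r⁻¹
      ≤ ((A.card : ℝ) ^ (r - 2) * A.card) ^ r⁻¹ := by
        refine Real.rpow_le_rpow (integral_nonneg fun x => by positivity) hle (by positivity)
    _ = (A.card : ℝ) ^ (1 - 1 / r) := by
        rw [← Real.rpow_add_one hc.ne', ← Real.rpow_mul hc.le]
        congr 1
        field_simp
        ring

/-- Hölder's inequality `|∫ w D_A D̄_B| ≤ ‖w‖_p ‖D_A‖_{2p'} ‖D_B‖_{2p'}`, read in Fourier space. -/
theorem norm_sum_mFourierCoeff_le {w : Torus d → ℂ} {p : ℝ} (hp : 1 < p)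
    (hw : MemLp w (ENNReal.ofReal p) (torusMeasure d)) (A B : Finset (Fin d → ℤ)) :
    ‖∑ k ∈ A, ∑ l ∈ B, mFourierCoeff w (-(k - l))‖ ≤
      (eLpNorm w (ENNReal.ofReal p) (torusMeasure d)).toReal *
        (A.card : ℝ) ^ (1 / 2 + 1 / (2 * p)) * (B.card : ℝ) ^ (1 / 2 + 1 / (2 * p)) := by
  have hp0 : 0 < p := by linarith
  have hp1 : 0 < p - 1 := by linarith
  -- `q` is the exponent conjugate to `p`; each Dirichlet kernel is measured in `L^{2q}`
  set q : ℝ := p / (p - 1) with hq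
  have hqpos : 0 < q := by positivity
  have hq1 : 1 ≤ q := by rw [hq, le_div_iff₀ hp1]; linarith
  have hpq : (ENNReal.ofReal q).HolderTriple (ENNReal.ofReal p) 1 := by
    constructor
    rw [← ENNReal.ofReal_inv_of_pos hqpos, ← ENNReal.ofReal_inv_of_pos hp0,
      ← ENNReal.ofReal_add (by positivity) (by positivity), inv_one]
    rw [ENNReal.ofReal_eq_one, hq]
    field_simp
    ring
  have hqq : (ENNReal.ofReal (2 * q)).HolderTriple (ENNReal.ofReal (2 * q)) (ENNReal.ofReal q) := by
    constructor
    rw [← ENNReal.ofReal_inv_of_pos hqpos, ← ENNReal.ofReal_inv_of_pos (by positivity),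
      ← ENNReal.ofReal_add (by positivity) (by positivity)]
    congr 1
    field_simp
    ring
  have hexp : 1 - 1 / (2 * q) = 1 / 2 + 1 / (2 * p) := by
    rw [hq]; field_simp; ring
  have hwi : Integrable w (torusMeasure d) :=
    memLp_one_iff_integrable.mp (hw.mono_exponent (by simpa using hp.le))
  have hcoeff : ∑ k ∈ A, ∑ l ∈ B, mFourierCoeff w (-(k - l)) =
      ∫ x, (dirichletKernel A • fun x => conj (dirichletKernel B x)) x • w x
        ∂(torusMeasure d) := by
    simp only [Pi.smul_apply', smul_eq_mul, dirichletKernel_mul_conj]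
    have hI : ∀ k : Fin d → ℤ, Integrable (fun x => mFourier k x * w x) (torusMeasure d) :=
      fun k => hwi.bdd_mul (mFourier k).continuous.aestronglyMeasurable
        (ae_of_all _ fun x => (norm_mFourier_apply k x).le)
    simp only [Finset.sum_mul]
    rw [integral_finsetSum _ fun k _ => integrable_finsetSum _ fun l _ => hI _]
    refine Finset.sum_congr rfl fun k _ => ?_
    rw [integral_finsetSum _ fun l _ => hI _]
    refine Finset.sum_congr rfl fun l _ => ?_
    change ∫ x, mFourier (- -(k - l)) x • w x ∂(torusMeasure d) = _
    simp only [neg_neg, smul_eq_mul]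
  have hcont : Continuous fun x => conj (dirichletKernel B x) :=
    Complex.continuous_conj.comp (continuous_dirichletKernel B)
  rw [hcoeff]
  have h2q : 2 ≤ 2 * q := by linarith
  have hmain : eLpNorm ((dirichletKernel A • fun x => conj (dirichletKernel B x)) • w) 1
      (torusMeasure d) ≤ ENNReal.ofReal ((A.card : ℝ) ^ (1 / 2 + 1 / (2 * p))) *
        ENNReal.ofReal ((B.card : ℝ) ^ (1 / 2 + 1 / (2 * p))) *
        eLpNorm w (ENNReal.ofReal p) (torusMeasure d) := by
    refine (eLpNorm_smul_le_mul_eLpNorm (p := ENNReal.ofReal q) (q := ENNReal.ofReal p)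
      hw.aestronglyMeasurable
      ((continuous_dirichletKernel A).smul hcont).aestronglyMeasurable).trans ?_
    gcongr
    refine (eLpNorm_smul_le_mul_eLpNorm (p := ENNReal.ofReal (2 * q))
      (q := ENNReal.ofReal (2 * q)) hcont.aestronglyMeasurable
      (continuous_dirichletKernel A).aestronglyMeasurable).trans ?_
    have hB : eLpNorm (fun x => conj (dirichletKernel B x)) (ENNReal.ofReal (2 * q))
        (torusMeasure d) = eLpNorm (dirichletKernel B) (ENNReal.ofReal (2 * q))
        (torusMeasure d) := eLpNorm_congr_norm_ae (ae_of_all _ fun x => by simp)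
    rw [hB, ← hexp]
    exact mul_le_mul' (eLpNorm_dirichletKernel_le A h2q) (eLpNorm_dirichletKernel_le B h2q)
  calc ‖∫ x, (dirichletKernel A • fun x => conj (dirichletKernel B x)) x • w x
        ∂(torusMeasure d)‖
      ≤ (eLpNorm ((dirichletKernel A • fun x => conj (dirichletKernel B x)) • w) 1
          (torusMeasure d)).toReal := by
        refine (norm_integral_le_lintegral_norm _).trans (ENNReal.toReal_mono ?_ ?_)
        · exact (hmain.trans_lt (ENNReal.mul_lt_top
            (ENNReal.mul_lt_top ENNReal.ofReal_lt_top ENNReal.ofReal_lt_top) hw.2)).ne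
        · rw [eLpNorm_one_eq_lintegral_enorm]
          simp only [ofReal_norm]
          rfl
    _ ≤ _ := by
        refine (ENNReal.toReal_mono (ENNReal.mul_lt_top
            (ENNReal.mul_lt_top ENNReal.ofReal_lt_top ENNReal.ofReal_lt_top) hw.2).ne
            hmain).trans_eq ?_
        rw [ENNReal.toReal_mul, ENNReal.toReal_mul, ENNReal.toReal_ofReal (by positivity),
          ENNReal.toReal_ofReal (by positivity)]
        ring

/-! ### Summability of the interaction against the Green function -/

theorem freqNormSq_nonneg (k : Fin d → ℤ) : 0 ≤ freqNormSq k :=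
  Finset.sum_nonneg fun _ _ => sq_nonneg _

theorem eigenvalue_pos {κ : ℝ} (hκ : 0 < κ) (k : Fin d → ℤ) : 0 < eigenvalue κ k := by
  have := freqNormSq_nonneg k
  unfold eigenvalue
  positivity

/-- The dyadic cube `{k : |k_i| ≤ 2ⁿ for all i}` of frequencies. -/
def dyadicCube (d n : ℕ) : Finset (Fin d → ℤ) :=
  Fintype.piFinset fun _ => Finset.Icc (-2 ^ n) (2 ^ n)

theorem card_dyadicCube_le (d n : ℕ) : ((dyadicCube d n).card : ℝ) ≤ ((3 * 2 ^ n) ^ d : ℝ) := by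
  have h : (Finset.Icc (-2 ^ n : ℤ) (2 ^ n)).card ≤ 3 * 2 ^ n := by
    rw [Int.card_Icc]
    have : (1 : ℤ) ≤ 2 ^ n := one_le_pow₀ (by norm_num)
    zify
    rw [Int.toNat_of_nonneg (by linarith)]
    linarith
  rw [dyadicCube, Fintype.card_piFinset_const]
  exact_mod_cast Nat.pow_le_pow_left h _

/-- The smallest dyadic cube containing `k` has side comparable to `|k|`, hence `4ⁿ ≲ λ_k`. -/
theorem exists_dyadicCube_inv_eigenvalue_le {κ : ℝ} (hκ : 0 < κ) (k : Fin d → ℤ) :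
    ∃ n : ℕ, k ∈ dyadicCube d n ∧ (eigenvalue κ k)⁻¹ ≤ (1 + κ⁻¹) * (1 / 4 : ℝ) ^ n := by
  have hex : ∃ n : ℕ, k ∈ dyadicCube d n := by
    refine ⟨∑ i, (k i).natAbs, ?_⟩
    rw [dyadicCube, Fintype.mem_piFinset]
    intro i
    rw [Finset.mem_Icc, ← abs_le]
    have h1 : (k i).natAbs ≤ ∑ i, (k i).natAbs :=
      Finset.single_le_sum (f := fun i => (k i).natAbs) (fun _ _ => Nat.zero_le _)
        (Finset.mem_univ i)
    have h2 := h1.trans (Nat.lt_two_pow_self (n := ∑ i, (k i).natAbs)).le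
    rw [Int.abs_eq_natAbs]
    exact_mod_cast h2
  classical
  refine ⟨Nat.find hex, Nat.find_spec hex, ?_⟩
  have hlam := eigenvalue_pos hκ k
  rcases hn : Nat.find hex with _ | m
  · have : (eigenvalue κ k)⁻¹ ≤ κ⁻¹ := by
      refine inv_anti₀ hκ ?_
      have := freqNormSq_nonneg k
      unfold eigenvalue
      nlinarith [Real.pi_pos, sq_nonneg Real.pi, mul_nonneg (sq_nonneg Real.pi) this]
    simpa using this.trans (by linarith)
  · have hnot : k ∉ dyadicCube d m := Nat.find_min hex (by omega)
    rw [dyadicCube, Fintype.mem_piFinset] at hnot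
    push Not at hnot
    obtain ⟨i, hi⟩ := hnot
    rw [Finset.mem_Icc, ← abs_le, not_le] at hi
    have h1 : ((2 : ℝ) ^ m) ^ 2 ≤ (k i : ℝ) ^ 2 := by
      rw [← sq_abs (k i : ℝ)]
      have : (2 : ℝ) ^ m ≤ |(k i : ℝ)| := by exact_mod_cast hi.le
      gcongr
    have h2 : (k i : ℝ) ^ 2 ≤ freqNormSq k :=
      Finset.single_le_sum (f := fun i => (k i : ℝ) ^ 2) (fun _ _ => sq_nonneg _)
        (Finset.mem_univ i)
    have h3 : (4 : ℝ) ^ (m + 1) ≤ eigenvalue κ k := by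
      have h4 : (4 : ℝ) ^ m = ((2 : ℝ) ^ m) ^ 2 := by
        rw [← pow_mul, mul_comm, pow_mul]; norm_num
      have hpi : 1 ≤ Real.pi ^ 2 := by nlinarith [Real.pi_gt_three]
      have hf := freqNormSq_nonneg k
      unfold eigenvalue
      rw [pow_succ, h4]
      nlinarith [mul_le_mul_of_nonneg_right hpi hf]
    calc (eigenvalue κ k)⁻¹ ≤ ((4 : ℝ) ^ (m + 1))⁻¹ := inv_anti₀ (by positivity) h3
      _ = 1 * (1 / 4 : ℝ) ^ (m + 1) := by rw [one_mul, one_div, inv_pow]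
      _ ≤ _ := by
        gcongr
        linarith [inv_pos.mpr hκ]

/-- A potential whose Fourier coefficients satisfy `∑_{A × B} β(k - l) ≤ C (|A| |B|)^θ` with
`θ d < 2` pairs with the square of the Green function: decompose each frequency variable into
dyadic shells, on which `1 / λ_k ≲ 4⁻ⁿ`. -/
theorem summable_mul_inv_eigenvalue {κ : ℝ} (hκ : 0 < κ) {β : (Fin d → ℤ) → ℝ} (hβ : ∀ q, 0 ≤ β q)
    {C θ : ℝ} (hC : 0 ≤ C) (hθ0 : 0 ≤ θ) (hθ : d * θ < 2)
    (h : ∀ A B : Finset (Fin d → ℤ),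
      ∑ k ∈ A, ∑ l ∈ B, β (k - l) ≤ C * (A.card : ℝ) ^ θ * (B.card : ℝ) ^ θ) :
    Summable fun p : (Fin d → ℤ) × (Fin d → ℤ) =>
      β (p.1 - p.2) * ((eigenvalue κ p.1)⁻¹ * (eigenvalue κ p.2)⁻¹) := by
  classical
  choose level hmem hle using fun k : Fin d → ℤ => exists_dyadicCube_inv_eigenvalue_le hκ k
  have hg : ∀ k : Fin d → ℤ, 0 ≤ (eigenvalue κ k)⁻¹ := fun k =>
    inv_nonneg.mpr (eigenvalue_pos hκ k).le
  set D : ℝ := 1 + κ⁻¹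
  have hD : 0 ≤ D := by positivity
  -- up to constants, `x n * x m` bounds the sum over the product of the `n`-th and `m`-th shells
  set x : ℕ → ℝ := fun n => (1 / 4 : ℝ) ^ n * ((3 * 2 ^ n) ^ d : ℝ) ^ θ with hx
  have hx0 : ∀ n, 0 ≤ x n := fun n => by positivity
  have hxs : Summable x := by
    have hr : (2 : ℝ) ^ (d * θ - 2) < 1 :=
      Real.rpow_lt_one_of_one_lt_of_neg (by norm_num) (by linarith)
    refine ((summable_geometric_of_lt_one (by positivity) hr).mul_left
      ((3 : ℝ) ^ (d * θ))).congr fun n => ?_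
    have e1 : ((3 * 2 ^ n) ^ d : ℝ) ^ θ = (3 : ℝ) ^ (d * θ) * ((2 : ℝ) ^ (d * θ)) ^ n := by
      rw [← Real.rpow_natCast (3 * 2 ^ n), ← Real.rpow_mul (by positivity),
        Real.mul_rpow (by norm_num) (by positivity), ← Real.rpow_natCast,
        ← Real.rpow_natCast, ← Real.rpow_mul (by norm_num), ← Real.rpow_mul (by norm_num),
        mul_comm (n : ℝ)]
    simp only [hx]
    rw [e1, Real.rpow_sub (by norm_num), div_pow, one_div, inv_pow]
    norm_num
    ring
  refine summable_of_sum_le (c := D ^ 2 * C * (∑' n, x n) ^ 2)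
    (fun p => mul_nonneg (hβ _) (mul_nonneg (hg _) (hg _))) fun P => ?_
  set A : Finset (Fin d → ℤ) := P.image Prod.fst ∪ P.image Prod.snd
  set R := A.image level
  set S : ℕ → Finset (Fin d → ℤ) := fun n => {k ∈ A | level k = n}
  have hfib : ∀ f : (Fin d → ℤ) → ℝ, ∑ k ∈ A, f k = ∑ n ∈ R, ∑ k ∈ S n, f k := fun f =>
    (Finset.sum_fiberwise_of_maps_to (g := level)
      (fun k hk => Finset.mem_image_of_mem level hk) f).symm
  have hcard : ∀ n, ((S n).card : ℝ) ≤ ((3 * 2 ^ n) ^ d : ℝ) := fun n => by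
    refine le_trans ?_ (card_dyadicCube_le d n)
    have hsub : S n ⊆ dyadicCube d n := fun k hk => by
      have := hmem k
      rwa [(Finset.mem_filter.mp hk).2] at this
    exact_mod_cast Finset.card_le_card hsub
  have hshell : ∀ n m, ∑ k ∈ S n, ∑ l ∈ S m,
      β (k - l) * ((eigenvalue κ k)⁻¹ * (eigenvalue κ l)⁻¹) ≤ D ^ 2 * C * (x n * x m) := by
    intro n m
    calc ∑ k ∈ S n, ∑ l ∈ S m, β (k - l) * ((eigenvalue κ k)⁻¹ * (eigenvalue κ l)⁻¹)
        ≤ ∑ k ∈ S n, ∑ l ∈ S m,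
            β (k - l) * ((D * (1 / 4 : ℝ) ^ n) * (D * (1 / 4 : ℝ) ^ m)) := by
          refine Finset.sum_le_sum fun k hk => Finset.sum_le_sum fun l hl => ?_
          have hk' := hle k
          have hl' := hle l
          rw [(Finset.mem_filter.mp hk).2] at hk'
          rw [(Finset.mem_filter.mp hl).2] at hl'
          exact mul_le_mul_of_nonneg_left
            (mul_le_mul hk' hl' (hg l) (by positivity)) (hβ _)
      _ = (∑ k ∈ S n, ∑ l ∈ S m, β (k - l)) *
            ((D * (1 / 4 : ℝ) ^ n) * (D * (1 / 4 : ℝ) ^ m)) := by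
          simp only [Finset.sum_mul]
      _ ≤ (C * ((3 * 2 ^ n) ^ d : ℝ) ^ θ * ((3 * 2 ^ m) ^ d : ℝ) ^ θ) *
            ((D * (1 / 4 : ℝ) ^ n) * (D * (1 / 4 : ℝ) ^ m)) := by
          refine mul_le_mul_of_nonneg_right ((h _ _).trans ?_) (by positivity)
          have h1 := Real.rpow_le_rpow (by positivity) (hcard n) hθ0
          have h2 := Real.rpow_le_rpow (by positivity) (hcard m) hθ0
          exact mul_le_mul (mul_le_mul_of_nonneg_left h1 hC) h2 (by positivity) (by positivity)
      _ = D ^ 2 * C * (x n * x m) := by simp only [hx]; ring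
  calc ∑ p ∈ P, β (p.1 - p.2) * ((eigenvalue κ p.1)⁻¹ * (eigenvalue κ p.2)⁻¹)
      ≤ ∑ p ∈ A ×ˢ A, β (p.1 - p.2) * ((eigenvalue κ p.1)⁻¹ * (eigenvalue κ p.2)⁻¹) := by
        refine Finset.sum_le_sum_of_subset_of_nonneg (fun p hp => ?_)
          fun p _ _ => mul_nonneg (hβ _) (mul_nonneg (hg _) (hg _))
        exact Finset.mem_product.mpr
          ⟨Finset.mem_union_left _ (Finset.mem_image_of_mem _ hp),
            Finset.mem_union_right _ (Finset.mem_image_of_mem _ hp)⟩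
    _ = ∑ n ∈ R, ∑ m ∈ R, ∑ k ∈ S n, ∑ l ∈ S m,
          β (k - l) * ((eigenvalue κ k)⁻¹ * (eigenvalue κ l)⁻¹) := by
        rw [Finset.sum_product, hfib]
        refine Finset.sum_congr rfl fun n _ => ?_
        rw [Finset.sum_comm]
        simp only [hfib]
        refine Finset.sum_congr rfl fun m _ => ?_
        rw [Finset.sum_comm]
    _ ≤ ∑ n ∈ R, ∑ m ∈ R, D ^ 2 * C * (x n * x m) :=
        Finset.sum_le_sum fun n _ => Finset.sum_le_sum fun m _ => hshell n m
    _ = D ^ 2 * C * (∑ n ∈ R, x n) ^ 2 := by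
        rw [sq (∑ n ∈ R, x n), Finset.sum_mul_sum]
        simp only [Finset.mul_sum]
    _ ≤ D ^ 2 * C * (∑' n, x n) ^ 2 := by
        have h1 := hxs.sum_le_tsum R fun n _ => hx0 n
        have h0 : 0 ≤ ∑ n ∈ R, x n := Finset.sum_nonneg fun n _ => hx0 n
        gcongr

/-- The real part of the Fourier coefficient `ŵ(-q) = ∫ w(x) e^{2πi q·x} dx`. The sign is the one
with which the coefficient enters the Fourier representation of the interaction. -/
def potentialCoeff (w : Torus d → ℂ) (q : Fin d → ℤ) : ℝ := (mFourierCoeff w (-q)).re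

theorem IsPositiveType.potentialCoeff_nonneg {w : Torus d → ℂ} (hw : IsPositiveType w)
    (q : Fin d → ℤ) : 0 ≤ potentialCoeff w q := (hw (-q)).1

theorem IsPositiveType.coe_potentialCoeff {w : Torus d → ℂ} (hw : IsPositiveType w)
    (q : Fin d → ℤ) : (potentialCoeff w q : ℂ) = mFourierCoeff w (-q) :=
  Complex.ext (by simp [potentialCoeff]) (by simp [(hw (-q)).2])

/-- Admissible potentials: `p > 1` for `d = 2` and `p > 3` for `d = 3` are both the condition
`d (1/2 + 1/(2p)) < 2`. -/
theorem summable_potentialCoeff_of_memLp {κ : ℝ} (hκ : 0 < κ) {w : Torus d → ℂ}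
    (hpos : IsPositiveType w) {p : ℝ} (hp : 1 < p) (hdp : d * (1 / 2 + 1 / (2 * p)) < 2)
    (hw : MemLp w (ENNReal.ofReal p) (torusMeasure d)) :
    Summable fun r : (Fin d → ℤ) × (Fin d → ℤ) =>
      potentialCoeff w (r.1 - r.2) * ((eigenvalue κ r.1)⁻¹ * (eigenvalue κ r.2)⁻¹) := by
  refine summable_mul_inv_eigenvalue hκ hpos.potentialCoeff_nonneg
    (C := (eLpNorm w (ENNReal.ofReal p) (torusMeasure d)).toReal) ENNReal.toReal_nonneg
    (by positivity) hdp fun A B => ?_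
  refine le_trans ?_ (norm_sum_mFourierCoeff_le hp hw A B)
  refine le_trans (le_of_eq ?_) (Complex.re_le_norm _)
  simp [potentialCoeff]

theorem norm_sq_le_freqNormSq (k : Fin d → ℤ) : ‖k‖ ^ 2 ≤ freqNormSq k := by
  have h : ‖k‖ ≤ √(freqNormSq k) := by
    refine (pi_norm_le_iff_of_nonneg (Real.sqrt_nonneg _)).mpr fun i => ?_
    rw [Int.norm_eq_abs]
    refine Real.abs_le_sqrt ?_
    exact Finset.single_le_sum (f := fun i => (k i : ℝ) ^ 2) (fun _ _ => sq_nonneg _)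
      (Finset.mem_univ i)
  exact (Real.le_sqrt (norm_nonneg _) (freqNormSq_nonneg k)).mp h

theorem japaneseBracket_nonneg (k : Fin d → ℤ) : 0 ≤ japaneseBracket k := Real.sqrt_nonneg _

theorem summable_japaneseBracket_rpow {s : ℝ} (hs : 2 < s) :
    Summable fun k : Fin 2 → ℤ => japaneseBracket k ^ (-s) := by
  have h := EisensteinSeries.summable_one_div_norm_rpow hs
  refine Summable.of_norm_bounded_eventually h ?_
  rw [Filter.eventually_cofinite]
  refine (Set.finite_singleton (0 : Fin 2 → ℤ)).subset fun k hk => ?_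
  by_contra hk0
  refine hk ?_
  have hk' : 0 < ‖k‖ := norm_pos_iff.mpr hk0
  have hle : ‖k‖ ≤ japaneseBracket k :=
    Real.le_sqrt_of_sq_le ((norm_sq_le_freqNormSq k).trans (by linarith))
  rw [Real.norm_of_nonneg (Real.rpow_nonneg (japaneseBracket_nonneg _) _)]
  exact Real.rpow_le_rpow_of_nonpos hk' hle (by linarith)

theorem japaneseBracket_neg (k : Fin d → ℤ) : japaneseBracket (-k) = japaneseBracket k := by
  simp [japaneseBracket, freqNormSq]

/-- In two dimensions, power decay of the coefficients gives `β ∈ ℓʳ` for large `r`, and Hölder's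
inequality bounds the sum over `A × B` by both `|A|^{1-1/r} |B|` and `|A| |B|^{1-1/r}`, hence by
their geometric mean. -/
theorem summable_mul_inv_eigenvalue_of_decay {κ : ℝ} (hκ : 0 < κ) {β : (Fin 2 → ℤ) → ℝ}
    (hβ : ∀ q, 0 ≤ β q) {ε L : ℝ} (hε : 0 < ε) (hL : 0 < L)
    (hdec : ∀ q, β q ≤ L * japaneseBracket q ^ (-ε)) :
    Summable fun p : (Fin 2 → ℤ) × (Fin 2 → ℤ) =>
      β (p.1 - p.2) * ((eigenvalue κ p.1)⁻¹ * (eigenvalue κ p.2)⁻¹) := by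
  -- any `r > max 1 (2 / ε)` makes `βʳ` summable on `ℤ²`
  set r : ℝ := 1 + 3 / ε with hr
  have hr1 : 1 < r := by rw [hr]; linarith [div_pos three_pos hε]
  have hr0 : 0 < r := by linarith
  have hεr : 2 < ε * r := by rw [hr, mul_add, mul_div_cancel₀ _ hε.ne']; linarith
  have hsum : Summable fun q => β q ^ r := by
    refine Summable.of_nonneg_of_le (fun q => Real.rpow_nonneg (hβ q) _) (fun q => ?_)
      ((summable_japaneseBracket_rpow hεr).mul_left (L ^ r))
    refine (Real.rpow_le_rpow (hβ q) (hdec q) hr0.le).trans_eq ?_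
    rw [Real.mul_rpow hL.le (Real.rpow_nonneg (japaneseBracket_nonneg _) _),
      ← Real.rpow_mul (japaneseBracket_nonneg _), neg_mul]
  set c : ℝ := (∑' q, β q ^ r) ^ (1 / r) with hc
  have hc0 : 0 ≤ c := Real.rpow_nonneg (tsum_nonneg fun q => Real.rpow_nonneg (hβ q) _) _
  have hconj : r.HolderConjugate (Real.conjExponent r) := Real.HolderConjugate.conjExponent hr1
  have hexp : 1 / Real.conjExponent r = 1 - 1 / r := by
    have := hconj.inv_add_inv_eq_one
    simp only [one_div]
    linarith
  have hone : ∀ (A : Finset (Fin 2 → ℤ)) (f : (Fin 2 → ℤ) → (Fin 2 → ℤ)),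
      Function.Injective f → ∑ k ∈ A, β (f k) ≤ c * (A.card : ℝ) ^ (1 - 1 / r) := by
    intro A f hf
    have h := Real.inner_le_Lp_mul_Lq A (fun k => β (f k)) (fun _ => 1) hconj
    simp only [mul_one, abs_one, Real.one_rpow, Finset.sum_const, nsmul_eq_mul, hexp,
      abs_of_nonneg (hβ _)] at h
    refine h.trans (mul_le_mul_of_nonneg_right ?_ (by positivity))
    refine Real.rpow_le_rpow (Finset.sum_nonneg fun k _ => Real.rpow_nonneg (hβ _) _) ?_
      (by positivity)
    rw [show ∑ k ∈ A, β (f k) ^ r = ∑ q ∈ A.map ⟨f, hf⟩, β q ^ r by rw [Finset.sum_map]; rfl]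
    exact hsum.sum_le_tsum _ fun q _ => Real.rpow_nonneg (hβ q) _
  refine summable_mul_inv_eigenvalue hκ hβ (θ := 1 - 1 / (2 * r)) hc0 ?_ ?_ fun A B => ?_
  · have : 1 / (2 * r) ≤ 1 := by rw [div_le_one (by positivity)]; linarith
    linarith
  · have : 0 < 1 / (2 * r) := by positivity
    push_cast
    linarith
  set T := ∑ k ∈ A, ∑ l ∈ B, β (k - l) with hT
  have hT0 : 0 ≤ T := Finset.sum_nonneg fun k _ => Finset.sum_nonneg fun l _ => hβ _
  have hT1 : T ≤ A.card * (c * (B.card : ℝ) ^ (1 - 1 / r)) := by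
    rw [← nsmul_eq_mul]
    exact Finset.sum_le_card_nsmul _ _ _ fun k _ => hone B (fun l => k - l) sub_right_injective
  have hT2 : T ≤ B.card * (c * (A.card : ℝ) ^ (1 - 1 / r)) := by
    rw [hT, Finset.sum_comm, ← nsmul_eq_mul]
    exact Finset.sum_le_card_nsmul _ _ _ fun l _ => hone A (fun k => k - l) sub_left_injective
  have hsplit : ∀ a : ℕ, (a : ℝ) * (a : ℝ) ^ (1 - 1 / r) = ((a : ℝ) ^ (1 - 1 / (2 * r))) ^ 2 := by
    intro a
    have hr' : 1 / r < 1 := by rw [div_lt_one hr0]; exact hr1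
    have h2r : 1 / (2 * r) = 1 / r / 2 := by field_simp
    rcases Nat.eq_zero_or_pos a with h0 | h0
    · subst h0
      have : 1 - 1 / r / 2 ≠ 0 := by linarith
      rw [h2r, Nat.cast_zero, Real.zero_rpow this]
      norm_num
    · have : (0 : ℝ) < a := by exact_mod_cast h0
      rw [← Real.rpow_one_add' this.le (by linarith), ← Real.rpow_mul_natCast this.le, h2r]
      congr 1
      push_cast
      ring
  refine abs_le_of_sq_le_sq' ?_ (by positivity) |>.2
  calc T ^ 2 ≤ (A.card * (c * (B.card : ℝ) ^ (1 - 1 / r))) *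
        (B.card * (c * (A.card : ℝ) ^ (1 - 1 / r))) := by
        rw [sq]; exact mul_le_mul hT1 hT2 hT0 (by positivity)
    _ = c ^ 2 * (A.card * (A.card : ℝ) ^ (1 - 1 / r)) *
        (B.card * (B.card : ℝ) ^ (1 - 1 / r)) := by ring
    _ = _ := by rw [hsplit, hsplit]; ring

/-- Both classes of potentials are of positive type, integrable, and pair with the square of the
Green function of `-Δ + κ`. -/
theorem summable_potentialCoeff (hd : d = 2 ∨ d = 3) {κ : ℝ} (hκ : 0 < κ) {w : Torus d → ℂ}
    (hw : IsAdmissible w ∨ IsEndpointAdmissible w) :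
    IsPositiveType w ∧ Integrable w (torusMeasure d) ∧
    Summable fun r : (Fin d → ℤ) × (Fin d → ℤ) =>
      potentialCoeff w (r.1 - r.2) * ((eigenvalue κ r.1)⁻¹ * (eigenvalue κ r.2)⁻¹) := by
  rcases hw with hw | hw
  · have hpos := hw.positiveType hd
    obtain ⟨p, hp, hmem⟩ := hw.memLp
    have key : 1 < p ∧ d * (1 / 2 + 1 / (2 * p)) < 2 := by
      rcases hd with rfl | rfl
      · have hp' : 1 < p := hp
        refine ⟨hp', ?_⟩
        have : 1 / p < 1 := by rw [div_lt_one (by linarith)]; exact hp'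
        have h2 : 1 / (2 * p) = 1 / p / 2 := by field_simp
        push_cast
        linarith
      · have hp' : 3 < p := hp
        refine ⟨by linarith, ?_⟩
        have : 1 / p < 1 / 3 := one_div_lt_one_div_of_lt (by norm_num) hp'
        have h2 : 1 / (2 * p) = 1 / p / 2 := by field_simp
        push_cast
        linarith
    exact ⟨hpos, memLp_one_iff_integrable.mp (hmem.mono_exponent (by simpa using key.1.le)),
      summable_potentialCoeff_of_memLp hκ hpos key.1 key.2 hmem⟩
  · obtain ⟨ε, hε, L, hL, hdec⟩ := hw.decay
    refine ⟨hw.positiveType, memLp_one_iff_integrable.mp hw.memLp, ?_⟩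
    have hpos := hw.positiveType
    obtain rfl := hw.dim
    exact summable_mul_inv_eigenvalue_of_decay hκ hpos.potentialCoeff_nonneg hε hL fun q => by
      simpa only [japaneseBracket_neg, potentialCoeff] using hdec (-q)

/-! ### Moments of sums of independent centred variables -/

section Moments

variable {Ω : Type*} [MeasurableSpace Ω] {μ : Measure Ω} {𝕜 : Type*} [RCLike 𝕜]

/-- Membership in `⋂_{p < ∞} Lᵖ(μ)`. -/
def HasAllMoments (X : Ω → 𝕜) (μ : Measure Ω) : Prop := ∀ p : ℝ≥0∞, p ≠ ∞ → MemLp X p μ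

namespace HasAllMoments

variable {X Y : Ω → 𝕜}

theorem aestronglyMeasurable (hX : HasAllMoments X μ) : AEStronglyMeasurable X μ :=
  (hX 1 ENNReal.one_ne_top).aestronglyMeasurable

theorem integrable (hX : HasAllMoments X μ) : Integrable X μ :=
  memLp_one_iff_integrable.mp (hX 1 ENNReal.one_ne_top)

theorem const [IsFiniteMeasure μ] (c : 𝕜) : HasAllMoments (fun _ : Ω => c) μ :=
  fun _ _ => memLp_const c

theorem add (hX : HasAllMoments X μ) (hY : HasAllMoments Y μ) :
    HasAllMoments (fun ω => X ω + Y ω) μ := fun p hp => (hX p hp).add (hY p hp)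

theorem sub (hX : HasAllMoments X μ) (hY : HasAllMoments Y μ) :
    HasAllMoments (fun ω => X ω - Y ω) μ := fun p hp => (hX p hp).sub (hY p hp)

theorem mul (hX : HasAllMoments X μ) (hY : HasAllMoments Y μ) :
    HasAllMoments (fun ω => X ω * Y ω) μ := fun p hp => by
  have : (2 * p).HolderTriple (2 * p) p := by
    constructor
    rw [ENNReal.mul_inv (Or.inl (by simp)) (Or.inl (by simp)), ← add_mul,
      ENNReal.inv_two_add_inv_two, one_mul]
  have h2 : 2 * p ≠ ∞ := ENNReal.mul_ne_top (by simp) hp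
  exact (hY _ h2).mul' (hX _ h2)

theorem const_mul (hX : HasAllMoments X μ) (c : 𝕜) : HasAllMoments (fun ω => c * X ω) μ :=
  fun p hp => (hX p hp).const_mul c

theorem sum {ι : Type*} {s : Finset ι} {Z : ι → Ω → 𝕜} (hZ : ∀ i ∈ s, HasAllMoments (Z i) μ) :
    HasAllMoments (fun ω => ∑ i ∈ s, Z i ω) μ :=
  fun p hp => memLp_finsetSum s fun i hi => hZ i hi p hp

theorem star (hX : HasAllMoments X μ) : HasAllMoments (fun ω => (starRingEnd 𝕜) (X ω)) μ :=
  fun p hp => MemLp.star (hX p hp)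

theorem norm (hX : HasAllMoments X μ) : HasAllMoments (fun ω => ‖X ω‖) μ :=
  fun p hp => (hX p hp).norm

theorem ofReal {Z : Ω → ℝ} (hZ : HasAllMoments Z μ) : HasAllMoments (fun ω => (Z ω : ℂ)) μ :=
  fun p hp => (hZ p hp).ofReal

theorem pow [IsFiniteMeasure μ] (hX : HasAllMoments X μ) (n : ℕ) :
    HasAllMoments (fun ω => X ω ^ n) μ := by
  induction n with
  | zero => simpa using const (μ := μ) (1 : 𝕜)
  | succ n ih => simpa only [pow_succ] using ih.mul hX

end HasAllMoments

/-- The real-variable form of `exists_norm_add_pow_le`, with `a = |x|²`, `b = |y|²` and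
`r = Re (x ȳ)`. -/
theorem exists_add_pow_le (n : ℕ) : ∃ D : ℝ, 0 ≤ D ∧ ∀ a b r : ℝ, 0 ≤ a → 0 ≤ b → r ^ 2 ≤ a * b →
    (a + 2 * r + b) ^ (n + 1) ≤
      a ^ (n + 1) + 2 * (n + 1) * (a ^ n * r) + D * (a ^ n * b + b ^ (n + 1)) := by
  induction n with
  | zero => exact ⟨1, zero_le_one, fun a b r _ hb _ => by norm_num; linarith⟩
  | succ n ih =>
    obtain ⟨D, hD, h⟩ := ih
    refine ⟨1 + 8 * (n + 1) + 6 * D, by positivity, fun a b r ha hb hr => ?_⟩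
    have habs : |r| ≤ (a + b) / 2 := abs_le_of_sq_le_sq (by nlinarith [sq_nonneg (a - b)])
      (by positivity)
    obtain ⟨h1, h2⟩ := abs_le.mp habs
    have hS0 : 0 ≤ a + 2 * r + b := by linarith
    have hS : a + 2 * r + b ≤ 2 * (a + b) := by linarith
    have han : 0 ≤ a ^ n := by positivity
    have hbn : 0 ≤ b ^ n := by positivity
    have e1 : a ^ n * b ^ 2 ≤ a ^ (n + 1) * b + b ^ (n + 2) := by
      rcases le_total a b with hab | hab
      · have := mul_le_mul_of_nonneg_right (pow_le_pow_left₀ ha hab n) (sq_nonneg b)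
        have h3 : 0 ≤ a ^ (n + 1) * b := by positivity
        calc a ^ n * b ^ 2 ≤ b ^ n * b ^ 2 := this
          _ ≤ a ^ (n + 1) * b + b ^ (n + 2) := by rw [← pow_add]; linarith
      · have h3 : 0 ≤ b ^ (n + 2) := by positivity
        have := mul_le_mul_of_nonneg_left hab (mul_nonneg han hb)
        calc a ^ n * b ^ 2 = a ^ n * b * b := by ring
          _ ≤ a ^ n * b * a := this
          _ ≤ a ^ (n + 1) * b + b ^ (n + 2) := by rw [pow_succ]; linarith
    have e2 : a * b ^ (n + 1) ≤ a ^ (n + 1) * b + b ^ (n + 2) := by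
      rcases le_total a b with hab | hab
      · have := mul_le_mul_of_nonneg_right hab (pow_nonneg hb (n + 1))
        have h3 : 0 ≤ a ^ (n + 1) * b := by positivity
        calc a * b ^ (n + 1) ≤ b * b ^ (n + 1) := this
          _ ≤ a ^ (n + 1) * b + b ^ (n + 2) := by rw [pow_succ b (n + 1)]; linarith
      · have h3 : 0 ≤ b ^ (n + 2) := by positivity
        have := mul_le_mul_of_nonneg_left (pow_le_pow_left₀ hb hab n) (mul_nonneg ha hb)
        calc a * b ^ (n + 1) = a * b * b ^ n := by ring
          _ ≤ a * b * a ^ n := this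
          _ ≤ a ^ (n + 1) * b + b ^ (n + 2) := by rw [pow_succ a n]; linarith
    have e3 : a ^ n * (2 * r ^ 2 + r * b) ≤ 3 * (a ^ (n + 1) * b) + a ^ n * b ^ 2 := by
      have : 2 * r ^ 2 + r * b ≤ 3 * (a * b) + b ^ 2 := by
        nlinarith [mul_le_mul_of_nonneg_right h2 hb, mul_nonneg ha hb, sq_nonneg b]
      have := mul_le_mul_of_nonneg_left this han
      calc _ ≤ _ := this
        _ = _ := by ring
    have e4 : (a + 2 * r + b) * (a ^ n * b + b ^ (n + 1)) ≤
        6 * (a ^ (n + 1) * b + b ^ (n + 2)) := by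
      have := mul_le_mul_of_nonneg_right hS (show 0 ≤ a ^ n * b + b ^ (n + 1) by positivity)
      have e5 : 2 * (a + b) * (a ^ n * b + b ^ (n + 1)) =
        2 * (a ^ (n + 1) * b + a * b ^ (n + 1) + a ^ n * b ^ 2 + b ^ (n + 2)) := by ring
      linarith
    have hmul := mul_le_mul_of_nonneg_right (h a b r ha hb hr) hS0
    have hn : (0 : ℝ) ≤ n + 1 := by positivity
    have e6 := mul_le_mul_of_nonneg_left e4 hD
    have e7 := mul_le_mul_of_nonneg_left (e3.trans (add_le_add_right e1 _)) hn
    have e8 : 0 ≤ b ^ (n + 2) := by positivity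
    have e9 : 0 ≤ (n + 1 : ℝ) * b ^ (n + 2) := by positivity
    push_cast
    calc (a + 2 * r + b) ^ (n + 1 + 1) = (a + 2 * r + b) ^ (n + 1) * (a + 2 * r + b) := pow_succ _ _
      _ ≤ _ := hmul
      _ = a ^ (n + 2) + 2 * (n + 1 + 1) * (a ^ (n + 1) * r) + a ^ (n + 1) * b +
          2 * ((n + 1) * (a ^ n * (2 * r ^ 2 + r * b))) +
          D * ((a + 2 * r + b) * (a ^ n * b + b ^ (n + 1))) := by ring
      _ ≤ a ^ (n + 2) + 2 * (n + 1 + 1) * (a ^ (n + 1) * r) +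
          (1 + 8 * (n + 1) + 6 * D) * (a ^ (n + 1) * b + b ^ (n + 2)) := by linarith
      _ = _ := by ring

/-- Taylor's inequality for `z ↦ |z|^{2(n+1)}`. The first-order term is kept explicit because it is
linear in `ȳ`, and so vanishes in expectation for a centred `y` independent of `x`. -/
theorem exists_norm_add_pow_le (n : ℕ) : ∃ D : ℝ, 0 ≤ D ∧ ∀ x y : ℂ,
    ‖x + y‖ ^ (2 * (n + 1)) ≤
      ‖x‖ ^ (2 * (n + 1)) + 2 * (n + 1) * (((‖x‖ ^ (2 * n) : ℝ) : ℂ) * x * conj y).re +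
        D * (‖x‖ ^ (2 * n) * ‖y‖ ^ 2 + ‖y‖ ^ (2 * (n + 1))) := by
  obtain ⟨D, hD, h⟩ := exists_add_pow_le n
  refine ⟨D, hD, fun x y => ?_⟩
  have hr : (x * conj y).re ^ 2 ≤ ‖x‖ ^ 2 * ‖y‖ ^ 2 := by
    rw [← mul_pow]
    refine sq_le_sq' ?_ ?_
    · have := Complex.abs_re_le_norm (x * conj y)
      rw [norm_mul, Complex.norm_conj] at this
      exact (abs_le.mp this).1
    · have := Complex.re_le_norm (x * conj y)
      rwa [norm_mul, Complex.norm_conj] at this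
  have := h (‖x‖ ^ 2) (‖y‖ ^ 2) _ (by positivity) (by positivity) hr
  have e : ‖x + y‖ ^ 2 = ‖x‖ ^ 2 + 2 * (x * conj y).re + ‖y‖ ^ 2 := by
    simp only [← Complex.normSq_eq_norm_sq, Complex.normSq_add]
    ring
  rw [← e] at this
  simp only [← pow_mul] at this
  rwa [mul_assoc (Complex.ofReal _), Complex.re_ofReal_mul]

/-- Marcinkiewicz–Zygmund type bound: moments of a sum of centred variables, each independent of
the partial sums of the others, are controlled by the variance. -/
theorem exists_integral_norm_sum_pow_le [IsProbabilityMeasure μ] {ι : Type*} {Y : ι → Ω → ℂ}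
    (c : ι → ℝ) (hY : ∀ i, HasAllMoments (Y i) μ) (hY0 : ∀ i, ∫ ω, Y i ω ∂μ = 0) {M : ℕ → ℝ}
    (hM : ∀ i n, ∫ ω, ‖Y i ω‖ ^ (2 * n) ∂μ ≤ M n) (n : ℕ) :
    ∃ C : ℝ, 0 ≤ C ∧ ∀ s : Finset ι,
      (∀ t ⊆ s, ∀ i ∈ s, i ∉ t → IndepFun (fun ω => ∑ j ∈ t, (c j : ℂ) * Y j ω) (Y i) μ) →
      ∫ ω, ‖∑ i ∈ s, (c i : ℂ) * Y i ω‖ ^ (2 * n) ∂μ ≤ C * (∑ i ∈ s, c i ^ 2) ^ n := by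
  classical
  rcases isEmpty_or_nonempty ι with hι | ⟨⟨i₀⟩⟩
  · refine ⟨1, zero_le_one, fun s _ => ?_⟩
    rcases Nat.eq_zero_or_pos n with rfl | hn
    · simp
    · simp [Finset.eq_empty_of_isEmpty s, hn.ne']
  have hM0 : ∀ n, 0 ≤ M n := fun n => (integral_nonneg fun ω => by positivity).trans (hM i₀ n)
  induction n with
  | zero => exact ⟨1, zero_le_one, fun s _ => by simp⟩
  | succ n ih =>
    obtain ⟨C', hC', h'⟩ := ih
    obtain ⟨D, hD, hexp⟩ := exists_norm_add_pow_le n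
    -- this constant propagates along the induction on `s`: with `S` the sum over `t`, both
    -- `S ^ (n + 1) + S ^ n * c i ^ 2` and `S ^ (n + 1) + (c i ^ 2) ^ (n + 1)` are at most
    -- `(S + c i ^ 2) ^ (n + 1)`
    refine ⟨D * (C' * M 1 + M (n + 1)),
      mul_nonneg hD (add_nonneg (mul_nonneg hC' (hM0 _)) (hM0 _)), fun s => ?_⟩
    induction s using Finset.induction_on with
    | empty => intro _; simp
    | insert i t hit iht =>
      intro hind
      have ht := iht fun u hu j hj hju =>
        hind u (hu.trans (Finset.subset_insert _ _)) j (Finset.mem_insert_of_mem hj) hju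
      have ht' := h' t fun u hu j hj hju =>
        hind u (hu.trans (Finset.subset_insert _ _)) j (Finset.mem_insert_of_mem hj) hju
      have hi := hind t (Finset.subset_insert _ _) i (Finset.mem_insert_self _ _) hit
      set X : Ω → ℂ := fun ω => ∑ j ∈ t, (c j : ℂ) * Y j ω with hX
      have hXm : HasAllMoments X μ := HasAllMoments.sum fun j _ => (hY j).const_mul _
      have hZm : HasAllMoments (fun ω => (c i : ℂ) * Y i ω) μ := (hY i).const_mul _
      have hcross : ∫ ω, (((‖X ω‖ ^ (2 * n) : ℝ) : ℂ) * X ω * conj ((c i : ℂ) * Y i ω)).re ∂μ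
          = 0 := by
        have hc : HasAllMoments
            (fun ω => ((‖X ω‖ ^ (2 * n) : ℝ) : ℂ) * X ω * conj ((c i : ℂ) * Y i ω)) μ :=
          ((hXm.norm.pow _).ofReal.mul hXm).mul hZm.star
        have : ∫ ω, (((‖X ω‖ ^ (2 * n) : ℝ) : ℂ) * X ω) * conj ((c i : ℂ) * Y i ω) ∂μ = 0 := by
          have hI : IndepFun (fun ω => ((‖X ω‖ ^ (2 * n) : ℝ) : ℂ) * X ω)
              (fun ω => conj ((c i : ℂ) * Y i ω)) μ :=
            hi.comp (φ := fun z => ((‖z‖ ^ (2 * n) : ℝ) : ℂ) * z)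
              (ψ := fun z => conj ((c i : ℂ) * z)) (by fun_prop) (by fun_prop)
          rw [hI.integral_fun_mul_eq_mul_integral
            ((hXm.norm.pow _).ofReal.mul hXm).aestronglyMeasurable
            hZm.star.aestronglyMeasurable, integral_conj, integral_const_mul, hY0]
          simp
        have h2 := integral_re (𝕜 := ℂ) hc.integrable
        simp only [RCLike.re_to_complex] at h2
        rw [h2, this, Complex.zero_re]
      have hprod : ∫ ω, ‖X ω‖ ^ (2 * n) * ‖(c i : ℂ) * Y i ω‖ ^ 2 ∂μ ≤
          C' * (∑ j ∈ t, c j ^ 2) ^ n * (c i ^ 2 * M 1) := by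
        have hI : IndepFun (fun ω => ‖X ω‖ ^ (2 * n)) (fun ω => ‖(c i : ℂ) * Y i ω‖ ^ 2) μ :=
          hi.comp (φ := fun z => ‖z‖ ^ (2 * n)) (ψ := fun z => ‖(c i : ℂ) * z‖ ^ 2)
            (by fun_prop) (by fun_prop)
        rw [hI.integral_fun_mul_eq_mul_integral (hXm.norm.pow _).aestronglyMeasurable
          (hZm.norm.pow _).aestronglyMeasurable]
        refine mul_le_mul ht' ?_ (integral_nonneg fun ω => by positivity) (by positivity)
        simp only [norm_mul, mul_pow, Complex.norm_real, Real.norm_eq_abs, sq_abs]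
        rw [integral_const_mul]
        exact mul_le_mul_of_nonneg_left (by simpa using hM i 1) (sq_nonneg _)
      have hlast : ∫ ω, ‖(c i : ℂ) * Y i ω‖ ^ (2 * (n + 1)) ∂μ ≤
          (c i ^ 2) ^ (n + 1) * M (n + 1) := by
        simp only [norm_mul, mul_pow, Complex.norm_real, Real.norm_eq_abs]
        rw [integral_const_mul, pow_mul, sq_abs]
        exact mul_le_mul_of_nonneg_left (hM i (n + 1)) (by positivity)
      have i1 := (hXm.norm.pow (2 * (n + 1))).integrable
      have i2 : Integrable (fun ω => (((‖X ω‖ ^ (2 * n) : ℝ) : ℂ) * X ω *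
          conj ((c i : ℂ) * Y i ω)).re) μ :=
        (((hXm.norm.pow _).ofReal.mul hXm).mul hZm.star).integrable.re
      have i3 := ((hXm.norm.pow (2 * n)).mul (hZm.norm.pow 2)).integrable
      have i4 := (hZm.norm.pow (2 * (n + 1))).integrable
      have j1 : Integrable (fun ω => ‖X ω‖ ^ (2 * (n + 1)) + 2 * (n + 1) *
          (((‖X ω‖ ^ (2 * n) : ℝ) : ℂ) * X ω * conj ((c i : ℂ) * Y i ω)).re) μ :=
        i1.add (i2.const_mul _)
      have j2 : Integrable (fun ω => D * (‖X ω‖ ^ (2 * n) * ‖(c i : ℂ) * Y i ω‖ ^ 2 +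
          ‖(c i : ℂ) * Y i ω‖ ^ (2 * (n + 1)))) μ := (i3.add i4).const_mul _
      simp only [Finset.sum_insert hit]
      set S := ∑ j ∈ t, c j ^ 2
      have hS : 0 ≤ S := Finset.sum_nonneg fun j _ => sq_nonneg _
      have hci : 0 ≤ c i ^ 2 := sq_nonneg _
      calc ∫ ω, ‖(c i : ℂ) * Y i ω + X ω‖ ^ (2 * (n + 1)) ∂μ
          ≤ ∫ ω, (‖X ω‖ ^ (2 * (n + 1)) + 2 * (n + 1) * (((‖X ω‖ ^ (2 * n) : ℝ) : ℂ) * X ω *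
              conj ((c i : ℂ) * Y i ω)).re +
              D * (‖X ω‖ ^ (2 * n) * ‖(c i : ℂ) * Y i ω‖ ^ 2 +
                ‖(c i : ℂ) * Y i ω‖ ^ (2 * (n + 1)))) ∂μ := by
            refine integral_mono ((hZm.add hXm).norm.pow _).integrable
              (j1.add j2) fun ω => ?_
            change ‖(c i : ℂ) * Y i ω + X ω‖ ^ (2 * (n + 1)) ≤ _
            rw [add_comm]
            exact hexp _ _
        _ = ∫ ω, ‖X ω‖ ^ (2 * (n + 1)) ∂μ +
              D * (∫ ω, ‖X ω‖ ^ (2 * n) * ‖(c i : ℂ) * Y i ω‖ ^ 2 ∂μ +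
                ∫ ω, ‖(c i : ℂ) * Y i ω‖ ^ (2 * (n + 1)) ∂μ) := by
            rw [integral_add j1 j2, integral_add i1 (i2.const_mul _), integral_const_mul, hcross,
              integral_const_mul, integral_add i3 i4]
            ring
        _ ≤ D * (C' * M 1 + M (n + 1)) * S ^ (n + 1) +
              D * (C' * S ^ n * (c i ^ 2 * M 1) + (c i ^ 2) ^ (n + 1) * M (n + 1)) :=
            add_le_add ht (mul_le_mul_of_nonneg_left (add_le_add hprod hlast) hD)
        _ = D * (C' * M 1) * (S ^ (n + 1) + S ^ n * c i ^ 2) +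
              D * M (n + 1) * (S ^ (n + 1) + (c i ^ 2) ^ (n + 1)) := by ring
        _ ≤ D * (C' * M 1) * (c i ^ 2 + S) ^ (n + 1) +
              D * M (n + 1) * (c i ^ 2 + S) ^ (n + 1) := by
            have k1 : S ^ (n + 1) + S ^ n * c i ^ 2 ≤ (c i ^ 2 + S) ^ (n + 1) := by
              have := pow_le_pow_left₀ hS (show S ≤ c i ^ 2 + S by linarith) n
              calc S ^ (n + 1) + S ^ n * c i ^ 2 = S ^ n * (c i ^ 2 + S) := by ring
                _ ≤ (c i ^ 2 + S) ^ n * (c i ^ 2 + S) :=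
                  mul_le_mul_of_nonneg_right this (by positivity)
                _ = _ := (pow_succ _ _).symm
            have k2 : S ^ (n + 1) + (c i ^ 2) ^ (n + 1) ≤ (c i ^ 2 + S) ^ (n + 1) := by
              rw [add_comm (c i ^ 2)]
              exact pow_add_pow_le hS hci (Nat.succ_ne_zero n)
            exact add_le_add
              (mul_le_mul_of_nonneg_left k1 (mul_nonneg hD (mul_nonneg hC' (hM0 1))))
              (mul_le_mul_of_nonneg_left k2 (mul_nonneg hD (hM0 _)))
        _ = _ := by ring

end Moments

/-! ### The Gaussian free field and its Wick-ordered pairs -/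

theorem integral_complexGaussian {E : Type*} [NormedAddCommGroup E] [NormedSpace ℝ E] (f : ℂ → E) :
    ∫ z, f z ∂complexGaussian = ∫ z, (Real.pi⁻¹ * Real.exp (-‖z‖ ^ 2)) • f z := by
  rw [complexGaussian, integral_withDensity_eq_integral_toReal_smul (by fun_prop)
    (ae_of_all _ fun _ => ENNReal.ofReal_lt_top)]
  refine integral_congr_ae (ae_of_all _ fun z => ?_)
  simp only
  rw [ENNReal.toReal_ofReal (by positivity)]

theorem integral_norm_rpow_mul_exp {s : ℝ} (hs : 0 ≤ s) :
    ∫ z : ℂ, ‖z‖ ^ s * Real.exp (-‖z‖ ^ 2) = Real.pi * Real.Gamma ((s + 2) / 2) := by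
  have h := Complex.integral_rpow_mul_exp_neg_rpow (p := 2) (q := s) (by norm_num) (by linarith)
  simp only [Real.rpow_two] at h
  rw [h, mul_div_cancel_left₀ _ two_ne_zero]

theorem hasAllMoments_id_complexGaussian : HasAllMoments (fun z : ℂ => z) complexGaussian := by
  intro p hp
  obtain ⟨n, hn⟩ := ENNReal.exists_nat_gt hp
  refine MemLp.mono_exponent (q := ((n + 1 : ℕ) : ℝ≥0∞)) ?_
    (hn.le.trans (by exact_mod_cast Nat.le_succ n))
  rw [← integrable_norm_rpow_iff (by fun_prop) (by simp) (by simp), complexGaussian,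
    integrable_withDensity_iff_integrable_smul' (by fun_prop)
      (ae_of_all _ fun _ => ENNReal.ofReal_lt_top)]
  have hs : (0 : ℝ) ≤ (n + 1 : ℕ) := by positivity
  have h := integral_norm_rpow_mul_exp hs
  have hi : Integrable fun z : ℂ => ‖z‖ ^ ((n + 1 : ℕ) : ℝ) * Real.exp (-‖z‖ ^ 2) := by
    refine Integrable.of_integral_ne_zero ?_
    rw [h]
    have : 0 < Real.Gamma ((((n + 1 : ℕ) : ℝ) + 2) / 2) := Real.Gamma_pos_of_pos (by positivity)
    positivity
  refine (hi.const_mul Real.pi⁻¹).congr (ae_of_all _ fun z => ?_)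
  simp only [ENNReal.toReal_natCast, smul_eq_mul]
  rw [ENNReal.toReal_ofReal (by positivity)]
  ring

theorem integral_id_complexGaussian : ∫ z, z ∂complexGaussian = 0 := by
  rw [integral_complexGaussian]
  have h := integral_neg_eq_self (fun z : ℂ => (Real.pi⁻¹ * Real.exp (-‖z‖ ^ 2)) • z) volume
  simp only [norm_neg, smul_neg, integral_neg] at h
  exact self_eq_neg.mp h.symm

theorem integral_norm_sq_complexGaussian : ∫ z, ‖z‖ ^ 2 ∂complexGaussian = 1 := by
  rw [integral_complexGaussian]
  have h := integral_norm_rpow_mul_exp (s := 2) (by norm_num)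
  simp only [Real.rpow_two] at h
  have e : ∀ z : ℂ, (Real.pi⁻¹ * Real.exp (-‖z‖ ^ 2)) • ‖z‖ ^ 2 =
      Real.pi⁻¹ * (‖z‖ ^ 2 * Real.exp (-‖z‖ ^ 2)) := fun z => by rw [smul_eq_mul]; ring
  simp only [e]
  rw [integral_const_mul, h, show ((2 : ℝ) + 2) / 2 = 2 by norm_num, Real.Gamma_two, mul_one,
    inv_mul_cancel₀ Real.pi_ne_zero]

instance : IsProbabilityMeasure (freeFieldMeasure d) := by
  unfold freeFieldMeasure
  infer_instance

theorem measurePreserving_eval_freeFieldMeasure (k : Fin d → ℤ) :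
    MeasurePreserving (fun ω : (Fin d → ℤ) → ℂ => ω k) (freeFieldMeasure d) complexGaussian :=
  measurePreserving_eval_infinitePi (fun _ => complexGaussian) k

theorem integral_eval_freeFieldMeasure {E : Type*} [NormedAddCommGroup E] [NormedSpace ℝ E]
    (k : Fin d → ℤ) {f : ℂ → E} (hf : AEStronglyMeasurable f complexGaussian) :
    ∫ ω, f (ω k) ∂(freeFieldMeasure d) = ∫ z, f z ∂complexGaussian := by
  have h := measurePreserving_eval_freeFieldMeasure k
  rw [← h.map_eq, integral_map h.measurable.aemeasurable (by rwa [h.map_eq])]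

theorem hasAllMoments_eval (k : Fin d → ℤ) :
    HasAllMoments (fun ω : (Fin d → ℤ) → ℂ => ω k) (freeFieldMeasure d) := fun p hp =>
  (hasAllMoments_id_complexGaussian p hp).comp_measurePreserving
    (measurePreserving_eval_freeFieldMeasure k)

/-- Under the free field measure, measurable functions of disjoint finite sets of
coordinates are independent. -/
theorem indepFun_of_dependsOn_disjoint {β γ : Type*} [MeasurableSpace β] [MeasurableSpace γ]
    {f : ((Fin d → ℤ) → ℂ) → β} {g : ((Fin d → ℤ) → ℂ) → γ} (hf : Measurable f)
    (hg : Measurable g) {S T : Finset (Fin d → ℤ)} (hfS : DependsOn f S) (hgT : DependsOn g T)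
    (hST : Disjoint S T) : IndepFun f g (freeFieldMeasure d) := by
  classical
  have hind : iIndepFun (fun (k : Fin d → ℤ) (ω : (Fin d → ℤ) → ℂ) => ω k) (freeFieldMeasure d) :=
    iIndepFun_infinitePi (P := fun _ : Fin d → ℤ => complexGaussian) (X := fun _ z => z)
      fun _ => measurable_id
  have h := hind.indepFun_finset S T hST fun k => measurable_pi_apply k
  -- extension by zero turns a family indexed by `U` into a point of the whole space
  let ext (U : Finset (Fin d → ℤ)) (x : U → ℂ) : (Fin d → ℤ) → ℂ :=
    fun k => if hk : k ∈ U then x ⟨k, hk⟩ else 0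
  have hext : ∀ U, Measurable (ext U) := fun U => by
    refine measurable_pi_lambda _ fun k => ?_
    by_cases hk : k ∈ U
    · simpa [ext, hk] using measurable_pi_apply _
    · simp [ext, hk]
  have h' := h.comp (hf.comp (hext S)) (hg.comp (hext T))
  convert h' using 1
  · funext ω
    exact hfS fun k hk => by simp [ext, Finset.mem_coe.mp hk]
  · funext ω
    exact hgT fun k hk => by simp [ext, Finset.mem_coe.mp hk]

/-- The Wick-ordered product `ω_k ω̄_l - δ_{kl}` attached to a pair `(k, l)` of frequencies. -/
def wickPair (p : (Fin d → ℤ) × (Fin d → ℤ)) (ω : (Fin d → ℤ) → ℂ) : ℂ :=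
  ω p.1 * conj (ω p.2) - if p.1 = p.2 then 1 else 0

/-- The coefficient `(λ_k λ_l)^{-1/2}` attached to a pair `(k, l)` of frequencies. -/
def pairWeight (κ : ℝ) (p : (Fin d → ℤ) × (Fin d → ℤ)) : ℝ :=
  (√(eigenvalue κ p.1))⁻¹ * (√(eigenvalue κ p.2))⁻¹

theorem pairWeight_sq {κ : ℝ} (hκ : 0 < κ) (p : (Fin d → ℤ) × (Fin d → ℤ)) :
    pairWeight κ p ^ 2 = (eigenvalue κ p.1)⁻¹ * (eigenvalue κ p.2)⁻¹ := by
  rw [pairWeight, mul_pow, inv_pow, inv_pow, Real.sq_sqrt (eigenvalue_pos hκ _).le,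
    Real.sq_sqrt (eigenvalue_pos hκ _).le]

theorem measurable_wickPair (p : (Fin d → ℤ) × (Fin d → ℤ)) : Measurable (wickPair p) := by
  have h1 : Measurable fun ω : (Fin d → ℤ) → ℂ => ω p.1 := measurable_pi_apply _
  have h2 : Measurable fun ω : (Fin d → ℤ) → ℂ => ω p.2 := measurable_pi_apply _
  exact (h1.mul (Complex.continuous_conj.measurable.comp h2)).sub_const _

theorem hasAllMoments_wickPair (p : (Fin d → ℤ) × (Fin d → ℤ)) :
    HasAllMoments (wickPair p) (freeFieldMeasure d) :=
  ((hasAllMoments_eval p.1).mul (hasAllMoments_eval p.2).star).sub (HasAllMoments.const _)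

/-- The coordinates are uncorrelated with unit variance. -/
theorem integral_mul_conj_eval (k l : Fin d → ℤ) :
    ∫ ω, ω k * conj (ω l) ∂(freeFieldMeasure d) = if k = l then 1 else 0 := by
  split_ifs with h
  · subst h
    have e : ∀ z : ℂ, z * conj z = ((‖z‖ ^ 2 : ℝ) : ℂ) := fun z => by
      rw [Complex.mul_conj, Complex.normSq_eq_norm_sq]
    rw [integral_eval_freeFieldMeasure k (f := fun z : ℂ => z * conj z)
      (by fun_prop)]
    simp only [e]
    rw [integral_complex_ofReal, integral_norm_sq_complexGaussian, Complex.ofReal_one]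
  · have hI : IndepFun (fun ω : (Fin d → ℤ) → ℂ => ω k) (fun ω => conj (ω l))
        (freeFieldMeasure d) := by
      refine indepFun_of_dependsOn_disjoint (S := {k}) (T := {l}) (measurable_pi_apply _)
        (Complex.continuous_conj.measurable.comp (measurable_pi_apply _)) (fun x y hxy => ?_)
        (fun x y hxy => ?_) (by simpa using h)
      · exact hxy k (by simp)
      · simp only [hxy l (by simp)]
    rw [hI.integral_fun_mul_eq_mul_integral (hasAllMoments_eval k).aestronglyMeasurable
      (hasAllMoments_eval l).star.aestronglyMeasurable,
      integral_eval_freeFieldMeasure k (f := fun z : ℂ => z) (by fun_prop),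
      integral_id_complexGaussian, zero_mul]

theorem integral_wickPair (p : (Fin d → ℤ) × (Fin d → ℤ)) :
    ∫ ω, wickPair p ω ∂(freeFieldMeasure d) = 0 := by
  unfold wickPair
  rw [integral_sub ((hasAllMoments_eval p.1).mul (hasAllMoments_eval p.2).star).integrable
    (integrable_const _), integral_mul_conj_eval]
  simp

theorem exists_integral_norm_wickPair_le (n : ℕ) :
    ∃ M : ℝ, ∀ p : (Fin d → ℤ) × (Fin d → ℤ),
      ∫ ω, ‖wickPair p ω‖ ^ (2 * n) ∂(freeFieldMeasure d) ≤ M := by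
  set m : ℝ := ∫ z, ‖z‖ ^ (4 * n) ∂complexGaussian with hm
  refine ⟨2 ^ (2 * n - 1) * (m + m + 1), fun p => ?_⟩
  have hev : ∀ k : Fin d → ℤ, ∫ ω, ‖ω k‖ ^ (4 * n) ∂(freeFieldMeasure d) = m := fun k =>
    integral_eval_freeFieldMeasure k (f := fun z : ℂ => ‖z‖ ^ (4 * n)) (by fun_prop)
  have h1 := ((hasAllMoments_eval p.1).norm.pow (4 * n)).integrable
  have h2 := ((hasAllMoments_eval p.2).norm.pow (4 * n)).integrable
  have h12 : Integrable (fun ω : (Fin d → ℤ) → ℂ => ‖ω p.1‖ ^ (4 * n) + ‖ω p.2‖ ^ (4 * n))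
    (freeFieldMeasure d) := h1.add h2
  calc ∫ ω, ‖wickPair p ω‖ ^ (2 * n) ∂(freeFieldMeasure d)
      ≤ ∫ ω, 2 ^ (2 * n - 1) * (‖ω p.1‖ ^ (4 * n) + ‖ω p.2‖ ^ (4 * n) + 1)
          ∂(freeFieldMeasure d) := by
        refine integral_mono ((hasAllMoments_wickPair p).norm.pow _).integrable
          ((h12.add (integrable_const 1)).const_mul _) fun ω => ?_
        have hle : ‖wickPair p ω‖ ≤ ‖ω p.1‖ * ‖ω p.2‖ + 1 := by
          refine (norm_sub_le _ _).trans ?_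
          rw [norm_mul, Complex.norm_conj]
          gcongr
          split_ifs <;> simp
        have hmul : (‖ω p.1‖ * ‖ω p.2‖) ^ (2 * n) ≤ ‖ω p.1‖ ^ (4 * n) + ‖ω p.2‖ ^ (4 * n) := by
          have e : ∀ a : ℝ, a ^ (4 * n) = (a ^ (2 * n)) ^ 2 := fun a => by
            rw [← pow_mul]; congr 1; ring
          rw [mul_pow, e, e]
          nlinarith [sq_nonneg (‖ω p.1‖ ^ (2 * n) - ‖ω p.2‖ ^ (2 * n)),
            sq_nonneg (‖ω p.1‖ ^ (2 * n)), sq_nonneg (‖ω p.2‖ ^ (2 * n))]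
        calc ‖wickPair p ω‖ ^ (2 * n) ≤ (‖ω p.1‖ * ‖ω p.2‖ + 1) ^ (2 * n) :=
              pow_le_pow_left₀ (norm_nonneg _) hle _
          _ ≤ 2 ^ (2 * n - 1) * ((‖ω p.1‖ * ‖ω p.2‖) ^ (2 * n) + 1 ^ (2 * n)) :=
              add_pow_le (by positivity) zero_le_one _
          _ ≤ _ := by rw [one_pow]; gcongr
    _ = _ := by
        rw [integral_const_mul, integral_add h12 (integrable_const 1), integral_add h1 h2,
          hev, hev]
        simp

/-- The contribution of the pairs in `P` with difference `q` to the `q`-th Fourier coefficient of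
the Wick-ordered density. -/
def densityMode (κ : ℝ) (P : Finset ((Fin d → ℤ) × (Fin d → ℤ))) (q : Fin d → ℤ)
    (ω : (Fin d → ℤ) → ℂ) : ℂ :=
  ∑ p ∈ P with p.1 - p.2 = q, (pairWeight κ p : ℂ) * wickPair p ω

theorem hasAllMoments_densityMode (κ : ℝ) (P : Finset ((Fin d → ℤ) × (Fin d → ℤ)))
    (q : Fin d → ℤ) : HasAllMoments (densityMode κ P q) (freeFieldMeasure d) :=
  HasAllMoments.sum fun p _ => (hasAllMoments_wickPair p).const_mul _

theorem indepFun_sum_wickPair (κ : ℝ) {s : Finset ((Fin d → ℤ) × (Fin d → ℤ))}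
    {p : (Fin d → ℤ) × (Fin d → ℤ)}
    (h : ∀ r ∈ s, r.1 ≠ p.1 ∧ r.1 ≠ p.2 ∧ r.2 ≠ p.1 ∧ r.2 ≠ p.2) :
    IndepFun (fun ω => ∑ r ∈ s, (pairWeight κ r : ℂ) * wickPair r ω) (wickPair p)
      (freeFieldMeasure d) := by
  classical
  refine indepFun_of_dependsOn_disjoint (S := s.image Prod.fst ∪ s.image Prod.snd)
    (T := {p.1, p.2}) (Finset.measurable_sum _ fun r _ => (measurable_wickPair r).const_mul _)
    (measurable_wickPair p) (fun x y hxy => ?_) (fun x y hxy => ?_) ?_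
  · refine Finset.sum_congr rfl fun r hr => ?_
    have h1 : x r.1 = y r.1 := hxy _ (Finset.mem_coe.mpr
      (Finset.mem_union_left _ (Finset.mem_image_of_mem _ hr)))
    have h2 : x r.2 = y r.2 := hxy _ (Finset.mem_coe.mpr
      (Finset.mem_union_right _ (Finset.mem_image_of_mem _ hr)))
    simp only [wickPair, h1, h2]
  · have h1 : x p.1 = y p.1 := hxy _ (by simp)
    have h2 : x p.2 = y p.2 := hxy _ (by simp)
    simp only [wickPair, h1, h2]
  · rw [Finset.disjoint_left]
    intro k hk hk'
    rw [Finset.mem_insert, Finset.mem_singleton] at hk'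
    rcases Finset.mem_union.mp hk with hk | hk <;>
      obtain ⟨r, hr, rfl⟩ := Finset.mem_image.mp hk <;>
      obtain ⟨h1, h2, h3, h4⟩ := h r hr <;> rcases hk' with hk' | hk' <;> contradiction

/-- The pairs with a given difference `q` split into two classes within each of which distinct pairs
share no frequency: along the lines of direction `q`, the first frequencies are taken from alternate
sites. -/
theorem exists_coloring (q : Fin d → ℤ) :
    ∃ color : (Fin d → ℤ) × (Fin d → ℤ) → Prop, ∀ p r : (Fin d → ℤ) × (Fin d → ℤ),
      p.1 - p.2 = q → r.1 - r.2 = q → (color p ↔ color r) → r ≠ p →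
        r.1 ≠ p.1 ∧ r.1 ≠ p.2 ∧ r.2 ≠ p.1 ∧ r.2 ≠ p.2 := by
  by_cases hq : q = 0
  · refine ⟨fun _ => True, fun p r hp hr _ hne => ?_⟩
    rw [hq, sub_eq_zero] at hp hr
    have : r.1 ≠ p.1 := fun h => hne (Prod.ext h (by rw [← hp, ← hr, h]))
    rw [← hp, ← hr]
    exact ⟨this, this, this, this⟩
  · obtain ⟨i, hi⟩ := Function.ne_iff.mp hq
    rw [Pi.zero_apply] at hi
    refine ⟨fun p => Even (p.1 i / q i), fun p r hp hr hc hne => ?_⟩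
    have hp' : p.2 = p.1 - q := by rw [← hp]; abel
    have hr' : r.2 = r.1 - q := by rw [← hr]; abel
    have hpar : ∀ x y : Fin d → ℤ, (Even (x i / q i) ↔ Even (y i / q i)) → x ≠ y - q := by
      rintro x y hxy rfl
      have : (y - q) i / q i = y i / q i - 1 := by
        rw [Pi.sub_apply, Int.sub_ediv_of_dvd _ (dvd_refl _), Int.ediv_self hi]
      rw [this, Int.even_sub_one] at hxy
      exact iff_not_self hxy.symm
    have h1 : r.1 ≠ p.1 := fun h => hne (Prod.ext h (by rw [hp', hr', h]))
    refine ⟨h1, ?_, ?_, ?_⟩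
    · rw [hp']; exact hpar _ _ hc.symm
    · rw [hr']; exact (hpar _ _ hc).symm
    · rw [hp', hr']; exact fun h => h1 (sub_left_injective h)

/-- The even moments of the modes of the Wick-ordered density are controlled by their variances,
uniformly in the mode and in the cutoff. -/
theorem exists_eLpNorm_densityMode_le {κ : ℝ} (hκ : 0 < κ) {n : ℕ} (hn : n ≠ 0) :
    ∃ C : ℝ, 0 ≤ C ∧ ∀ (P : Finset ((Fin d → ℤ) × (Fin d → ℤ))) (q : Fin d → ℤ),
      eLpNorm (densityMode κ P q) ((2 * n : ℕ) : ℝ≥0∞) (freeFieldMeasure d) ≤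
        ENNReal.ofReal (C * √(∑ p ∈ P with p.1 - p.2 = q,
          (eigenvalue κ p.1)⁻¹ * (eigenvalue κ p.2)⁻¹)) := by
  classical
  choose M hM using exists_integral_norm_wickPair_le (d := d)
  obtain ⟨C, hC, hbound⟩ := exists_integral_norm_sum_pow_le (μ := freeFieldMeasure d)
    (Y := wickPair) (pairWeight κ) hasAllMoments_wickPair integral_wickPair
    (fun p n => hM n p) n
  set C₁ : ℝ := 2 ^ (2 * n - 1) * (C + C) with hC₁
  have hC₁0 : 0 ≤ C₁ := by positivity
  have h2n : (2 * n : ℕ) ≠ 0 := by omega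
  refine ⟨C₁ ^ (((2 * n : ℕ) : ℝ)⁻¹), by positivity, fun P q => ?_⟩
  set σ : ℝ := ∑ p ∈ P with p.1 - p.2 = q, (eigenvalue κ p.1)⁻¹ * (eigenvalue κ p.2)⁻¹ with hσ
  have hσ0 : 0 ≤ σ := Finset.sum_nonneg fun p _ =>
    mul_nonneg (inv_nonneg.mpr (eigenvalue_pos hκ _).le) (inv_nonneg.mpr (eigenvalue_pos hκ _).le)
  obtain ⟨color, hcolor⟩ := exists_coloring q
  set F := {p ∈ P | p.1 - p.2 = q}
  have hFq : ∀ p ∈ F, p.1 - p.2 = q := fun p hp => (Finset.mem_filter.mp hp).2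
  have hclass : ∀ G ⊆ F, (∀ p ∈ G, ∀ r ∈ G, (color p ↔ color r)) →
      ∫ ω, ‖∑ p ∈ G, (pairWeight κ p : ℂ) * wickPair p ω‖ ^ (2 * n) ∂(freeFieldMeasure d) ≤
        C * σ ^ n := by
    intro G hG hGc
    refine (hbound G fun t ht p hp hpt => indepFun_sum_wickPair κ fun r hr =>
      hcolor p r (hFq p (hG hp)) (hFq r (hG (ht hr))) (hGc p hp r (ht hr))
        (fun h => hpt (h ▸ hr))).trans ?_
    refine mul_le_mul_of_nonneg_left (pow_le_pow_left₀
      (Finset.sum_nonneg fun p _ => sq_nonneg _) ?_ _) hC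
    simp only [pairWeight_sq hκ]
    exact Finset.sum_le_sum_of_subset_of_nonneg hG fun p _ _ =>
      mul_nonneg (inv_nonneg.mpr (eigenvalue_pos hκ _).le)
        (inv_nonneg.mpr (eigenvalue_pos hκ _).le)
  set G₁ := {p ∈ F | color p}
  set G₂ := {p ∈ F | ¬ color p}
  have hm : ∀ G : Finset ((Fin d → ℤ) × (Fin d → ℤ)), Integrable (fun ω =>
      ‖∑ p ∈ G, (pairWeight κ p : ℂ) * wickPair p ω‖ ^ (2 * n)) (freeFieldMeasure d) := fun G =>
    ((HasAllMoments.sum fun p _ => (hasAllMoments_wickPair p).const_mul _).norm.pow _).integrable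
  have hint : ∫ ω, ‖densityMode κ P q ω‖ ^ (2 * n) ∂(freeFieldMeasure d) ≤ C₁ * σ ^ n := by
    calc ∫ ω, ‖densityMode κ P q ω‖ ^ (2 * n) ∂(freeFieldMeasure d)
        ≤ ∫ ω, 2 ^ (2 * n - 1) *
            (‖∑ p ∈ G₁, (pairWeight κ p : ℂ) * wickPair p ω‖ ^ (2 * n) +
              ‖∑ p ∈ G₂, (pairWeight κ p : ℂ) * wickPair p ω‖ ^ (2 * n))
            ∂(freeFieldMeasure d) := by
          refine integral_mono (hm F) (((hm G₁).add (hm G₂)).const_mul _) fun ω => ?_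
          change ‖∑ p ∈ F, (pairWeight κ p : ℂ) * wickPair p ω‖ ^ (2 * n) ≤ _
          rw [← Finset.sum_filter_add_sum_filter_not F color]
          exact (pow_le_pow_left₀ (norm_nonneg _) (norm_add_le _ _) _).trans
            (add_pow_le (norm_nonneg _) (norm_nonneg _) _)
      _ ≤ 2 ^ (2 * n - 1) * (C * σ ^ n + C * σ ^ n) := by
          rw [integral_const_mul, integral_add (hm G₁) (hm G₂)]
          have h₁ := hclass G₁ (Finset.filter_subset _ _) fun p hp r hr =>
            iff_of_true (Finset.mem_filter.mp hp).2 (Finset.mem_filter.mp hr).2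
          have h₂ := hclass G₂ (Finset.filter_subset _ _) fun p hp r hr =>
            iff_of_false (Finset.mem_filter.mp hp).2 (Finset.mem_filter.mp hr).2
          gcongr
      _ = C₁ * σ ^ n := by rw [hC₁]; ring
  rw [(hasAllMoments_densityMode κ P q _ (ENNReal.natCast_ne_top _)).eLpNorm_eq_integral_rpow_norm
    (by exact_mod_cast h2n) (ENNReal.natCast_ne_top _), ENNReal.toReal_natCast]
  refine ENNReal.ofReal_le_ofReal ?_
  simp only [Real.rpow_natCast]
  refine (Real.rpow_le_rpow (integral_nonneg fun ω => by positivity) hint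
    (by positivity)).trans_eq ?_
  rw [Real.mul_rpow hC₁0 (by positivity)]
  congr 1
  rw [Real.sqrt_eq_rpow, ← Real.rpow_natCast, ← Real.rpow_mul hσ0]
  congr 1
  have : (n : ℝ) ≠ 0 := by exact_mod_cast hn
  push_cast
  field_simp

/-! ### The truncated interaction -/

/-- In Fourier space the quadratic form `∫∫ V(x) w(x - y) V(y) dx dy` of a real trigonometric
polynomial `V = ∑ a_q e^{2πi q·x}` is diagonal. -/
theorem integral_integral_convolution {w : Torus d → ℂ} (hw : Integrable w (torusMeasure d))
    {V : Torus d → ℝ} {Q : Finset (Fin d → ℤ)} {a : (Fin d → ℤ) → ℂ}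
    (hV : ∀ x, (V x : ℂ) = ∑ q ∈ Q, a q * mFourier q x) :
    ∫ x, ∫ y, (V x : ℂ) * w (x - y) * (V y : ℂ) ∂(torusMeasure d) ∂(torusMeasure d) =
      ∑ q ∈ Q, mFourierCoeff w (-q) * ((‖a q‖ ^ 2 : ℝ) : ℂ) := by
  have hVc : ∀ y, (V y : ℂ) = ∑ q ∈ Q, conj (a q) * conj (mFourier q y) := fun y => by
    rw [← Complex.conj_ofReal, hV, map_sum]
    simp only [map_mul]
  have hwe : ∀ q : Fin d → ℤ, Integrable (fun z => mFourier q z * w z) (torusMeasure d) :=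
    fun q => hw.bdd_mul (mFourier q).continuous.aestronglyMeasurable
      (ae_of_all _ fun x => (norm_mFourier_apply q x).le)
  have hcoeff : ∀ q : Fin d → ℤ,
      ∫ z, mFourier q z * w z ∂(torusMeasure d) = mFourierCoeff w (-q) := fun q => by
    change _ = ∫ x, mFourier (- -q) x • w x ∂(torusMeasure d)
    simp only [neg_neg, smul_eq_mul]
  have hinner : ∀ x, ∫ y, (V x : ℂ) * w (x - y) * (V y : ℂ) ∂(torusMeasure d) =
      ∑ q ∈ Q, conj (a q) * mFourierCoeff w (-q) * ((V x : ℂ) * conj (mFourier q x)) := by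
    intro x
    have hpt : ∀ y, (V x : ℂ) * w (x - y) * (V y : ℂ) =
        ∑ q ∈ Q, conj (a q) * ((V x : ℂ) * conj (mFourier q x)) *
          (mFourier q (x - y) * w (x - y)) := by
      intro y
      rw [hVc y, Finset.mul_sum]
      refine Finset.sum_congr rfl fun q _ => ?_
      have h1 : conj (mFourier q x) * mFourier q x = 1 := by
        rw [mul_comm, Complex.mul_conj, Complex.normSq_eq_norm_sq, norm_mFourier_apply]
        simp
      rw [mFourier_apply_sub]
      linear_combination (-(conj (a q) * (V x : ℂ) * conj (mFourier q y) * w (x - y))) * h1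
    simp only [hpt]
    rw [integral_finsetSum _ fun q _ => ((hwe q).comp_sub_left x).const_mul _]
    refine Finset.sum_congr rfl fun q _ => ?_
    rw [integral_const_mul,
      integral_sub_left_eq_self (fun z => mFourier q z * w z) (torusMeasure d) x, hcoeff]
    ring
  have hVcont : Continuous fun x => (V x : ℂ) := by
    simp only [hV]
    exact continuous_finsetSum _ fun q _ => continuous_const.mul (mFourier q).continuous
  have hconj : ∀ q : Fin d → ℤ, Continuous fun x : Torus d => conj (mFourier q x) := fun q =>
    Complex.continuous_conj.comp (mFourier q).continuous
  have hVe : ∀ q : Fin d → ℤ,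
      Integrable (fun x => (V x : ℂ) * conj (mFourier q x)) (torusMeasure d) := fun q =>
    integrable_of_continuous (hVcont.mul (hconj q))
  simp only [hinner]
  rw [integral_finsetSum _ fun q _ => (hVe q).const_mul _]
  refine Finset.sum_congr rfl fun q hq => ?_
  have hmode : ∫ x, (V x : ℂ) * conj (mFourier q x) ∂(torusMeasure d) = a q := by
    simp only [hV, Finset.sum_mul, mul_assoc, ← mFourier_sub]
    rw [integral_finsetSum _ fun r _ =>
      (integrable_of_continuous (mFourier (r - q)).continuous).const_mul _]
    simp_rw [integral_const_mul, integral_mFourier, sub_eq_zero]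
    simp [hq]
  rw [integral_const_mul, hmode, ← Complex.normSq_eq_norm_sq, ← Complex.mul_conj]
  ring

theorem norm_sq_truncField (κ : ℝ) (K : ℕ) (ω : (Fin d → ℤ) → ℂ) (x : Torus d) :
    ((‖truncField κ K ω x‖ ^ 2 : ℝ) : ℂ) = ∑ p ∈ freqBall d K ×ˢ freqBall d K,
      (pairWeight κ p : ℂ) * (ω p.1 * conj (ω p.2)) * mFourier (p.1 - p.2) x := by
  rw [← Complex.normSq_eq_norm_sq, ← Complex.mul_conj, truncField, map_sum, Finset.sum_mul_sum,
    ← Finset.sum_product']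
  refine Finset.sum_congr rfl fun p _ => ?_
  simp only [map_mul, map_div₀, Complex.conj_ofReal, mFourier_sub, pairWeight,
    Complex.ofReal_mul, Complex.ofReal_inv]
  ring

theorem truncDensity_eq (κ : ℝ) (K : ℕ) :
    (truncDensity κ d K : ℂ) = ∑ p ∈ freqBall d K ×ˢ freqBall d K,
      (pairWeight κ p : ℂ) * if p.1 = p.2 then 1 else 0 := by
  rw [truncDensity, ← integral_complex_ofReal]
  simp only [norm_sq_truncField, mFourier_zero_apply, mul_one]
  rw [integral_finsetSum _ fun p _ =>
    ((hasAllMoments_eval p.1).mul (hasAllMoments_eval p.2).star).integrable.const_mul _]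
  simp_rw [integral_const_mul, integral_mul_conj_eval]

/-- Fourier expansion of the Wick-ordered density `|φ|² - ϱ`. -/
theorem wickDensity_eq_sum (κ : ℝ) (K : ℕ) (ω : (Fin d → ℤ) → ℂ) {Q : Finset (Fin d → ℤ)}
    (hQ : ∀ p ∈ freqBall d K ×ˢ freqBall d K, p.1 - p.2 ∈ Q) (x : Torus d) :
    ((‖truncField κ K ω x‖ ^ 2 - truncDensity κ d K : ℝ) : ℂ) =
      ∑ q ∈ Q, densityMode κ (freqBall d K ×ˢ freqBall d K) q ω * mFourier q x := by
  rw [Complex.ofReal_sub, norm_sq_truncField, truncDensity_eq, ← Finset.sum_sub_distrib,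
    ← Finset.sum_fiberwise_of_maps_to hQ]
  refine Finset.sum_congr rfl fun q _ => ?_
  rw [densityMode, Finset.sum_mul]
  refine Finset.sum_congr rfl fun p hp => ?_
  rw [← (Finset.mem_filter.mp hp).2, wickPair]
  split_ifs with h
  · simp only [h, sub_self, mFourier_zero, ContinuousMap.one_apply]
    ring
  · ring

theorem truncInteraction_eq_sum (κ : ℝ) {w : Torus d → ℂ} (hpos : IsPositiveType w)
    (hw : Integrable w (torusMeasure d)) (K : ℕ) (ω : (Fin d → ℤ) → ℂ) {Q : Finset (Fin d → ℤ)}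
    (hQ : ∀ p ∈ freqBall d K ×ˢ freqBall d K, p.1 - p.2 ∈ Q) :
    truncInteraction κ w K ω = ∑ q ∈ Q, ((potentialCoeff w q / 2 : ℝ) : ℂ) *
      ((‖densityMode κ (freqBall d K ×ˢ freqBall d K) q ω‖ ^ 2 : ℝ) : ℂ) := by
  rw [truncInteraction, integral_integral_convolution hw (wickDensity_eq_sum κ K ω hQ),
    Finset.mul_sum]
  refine Finset.sum_congr rfl fun q _ => ?_
  rw [← hpos.coe_potentialCoeff]
  push_cast
  ring

theorem hasAllMoments_truncInteraction (κ : ℝ) {w : Torus d → ℂ} (hpos : IsPositiveType w)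
    (hw : Integrable w (torusMeasure d)) (K : ℕ) :
    HasAllMoments (truncInteraction κ w K) (freeFieldMeasure d) := by
  classical
  have h : truncInteraction κ w K = fun ω =>
      ∑ q ∈ (freqBall d K ×ˢ freqBall d K).image fun p => p.1 - p.2,
        ((potentialCoeff w q / 2 : ℝ) : ℂ) *
          ((‖densityMode κ (freqBall d K ×ˢ freqBall d K) q ω‖ ^ 2 : ℝ) : ℂ) :=
    funext fun ω => truncInteraction_eq_sum κ hpos hw K ω fun p hp =>
      Finset.mem_image_of_mem _ hp
  rw [h]
  exact HasAllMoments.sum fun q _ =>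
    (((hasAllMoments_densityMode κ _ q).norm.pow 2).ofReal).const_mul _

theorem eLpNorm_norm_sq_sub_norm_sq_le {Ω : Type*} [MeasurableSpace Ω] {μ : Measure Ω}
    {X X' : Ω → ℂ} (hX : AEStronglyMeasurable X μ) (hX' : AEStronglyMeasurable X' μ) {n : ℕ}
    (hn : n ≠ 0) :
    eLpNorm (fun ω => ((‖X ω‖ ^ 2 : ℝ) : ℂ) - ((‖X' ω‖ ^ 2 : ℝ) : ℂ)) n μ ≤
      eLpNorm (fun ω => X ω - X' ω) ((2 * n : ℕ) : ℝ≥0∞) μ *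
        (eLpNorm X ((2 * n : ℕ) : ℝ≥0∞) μ + eLpNorm X' ((2 * n : ℕ) : ℝ≥0∞) μ) := by
  have hH : ((2 * n : ℕ) : ℝ≥0∞).HolderTriple ((2 * n : ℕ) : ℝ≥0∞) n := by
    constructor
    push_cast
    rw [ENNReal.mul_inv (Or.inl (by simp)) (Or.inl (by simp)), ← add_mul,
      ENNReal.inv_two_add_inv_two, one_mul]
  have h1 : (1 : ℝ≥0∞) ≤ ((2 * n : ℕ) : ℝ≥0∞) := by exact_mod_cast (by omega : 1 ≤ 2 * n)
  calc eLpNorm (fun ω => ((‖X ω‖ ^ 2 : ℝ) : ℂ) - ((‖X' ω‖ ^ 2 : ℝ) : ℂ)) n μ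
      ≤ eLpNorm ((fun ω => ‖X ω - X' ω‖) • fun ω => ‖X ω‖ + ‖X' ω‖) n μ := by
        refine eLpNorm_mono fun ω => ?_
        rw [← Complex.ofReal_sub, Complex.norm_real, sq_sub_sq, norm_mul, mul_comm,
          Pi.smul_apply', norm_smul, norm_norm]
        gcongr
        exact abs_norm_sub_norm_le _ _
    _ ≤ eLpNorm (fun ω => ‖X ω - X' ω‖) ((2 * n : ℕ) : ℝ≥0∞) μ *
          eLpNorm (fun ω => ‖X ω‖ + ‖X' ω‖) ((2 * n : ℕ) : ℝ≥0∞) μ :=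
        eLpNorm_smul_le_mul_eLpNorm (hX.norm.add hX'.norm) (hX.sub hX').norm
    _ ≤ _ := by
        refine mul_le_mul' (eLpNorm_norm _).le ((eLpNorm_add_le hX.norm hX'.norm h1).trans ?_)
        rw [eLpNorm_norm, eLpNorm_norm]

theorem freqBall_mono (d : ℕ) {K K' : ℕ} (h : K' ≤ K) : freqBall d K' ⊆ freqBall d K :=
  fun _ hk => mem_freqBall.mpr ((mem_freqBall.mp hk).trans (by exact_mod_cast h))

/-- The distance of two truncated interactions in `Lⁿ` is bounded by a tail of the double series
`∑ ŵ(l - k) / (λ_k λ_l)`. -/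
theorem exists_eLpNorm_truncInteraction_sub_le {κ : ℝ} (hκ : 0 < κ) {w : Torus d → ℂ}
    (hpos : IsPositiveType w) (hw : Integrable w (torusMeasure d))
    (hsum : Summable fun r : (Fin d → ℤ) × (Fin d → ℤ) =>
      potentialCoeff w (r.1 - r.2) * ((eigenvalue κ r.1)⁻¹ * (eigenvalue κ r.2)⁻¹))
    {n : ℕ} (hn : n ≠ 0) :
    ∃ C : ℝ, 0 ≤ C ∧ ∀ K K' : ℕ, K' ≤ K →
      eLpNorm (truncInteraction κ w K - truncInteraction κ w K') n (freeFieldMeasure d) ≤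
        ENNReal.ofReal (C * √(∑ r ∈ (freqBall d K ×ˢ freqBall d K) \
          (freqBall d K' ×ˢ freqBall d K'),
          potentialCoeff w (r.1 - r.2) * ((eigenvalue κ r.1)⁻¹ * (eigenvalue κ r.2)⁻¹))) := by
  classical
  obtain ⟨C, hC, hmode⟩ := exists_eLpNorm_densityMode_le (d := d) hκ hn
  set F : (Fin d → ℤ) × (Fin d → ℤ) → ℝ := fun r =>
    potentialCoeff w (r.1 - r.2) * ((eigenvalue κ r.1)⁻¹ * (eigenvalue κ r.2)⁻¹) with hF
  set g : (Fin d → ℤ) × (Fin d → ℤ) → ℝ := fun r => (eigenvalue κ r.1)⁻¹ * (eigenvalue κ r.2)⁻¹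
  have hg : ∀ r, 0 ≤ g r := fun r =>
    mul_nonneg (inv_nonneg.mpr (eigenvalue_pos hκ _).le) (inv_nonneg.mpr (eigenvalue_pos hκ _).le)
  have hβ := hpos.potentialCoeff_nonneg
  have hF0 : ∀ r, 0 ≤ F r := fun r => mul_nonneg (hβ _) (hg r)
  refine ⟨C ^ 2 * √(∑' r, F r), by positivity, fun K K' hK => ?_⟩
  set P := freqBall d K ×ˢ freqBall d K with hP
  set P' := freqBall d K' ×ˢ freqBall d K' with hP'
  have hPP : P' ⊆ P := Finset.product_subset_product (freqBall_mono d hK) (freqBall_mono d hK)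
  set Q := P.image fun p => p.1 - p.2
  have hQ : ∀ p ∈ P, p.1 - p.2 ∈ Q := fun p hp =>
    Finset.mem_image_of_mem (fun p : (Fin d → ℤ) × (Fin d → ℤ) => p.1 - p.2) hp
  set A := densityMode κ P
  set A' := densityMode κ P'
  -- the variance of the `q`-th mode of the density built from the pairs in `S`
  set v : Finset ((Fin d → ℤ) × (Fin d → ℤ)) → (Fin d → ℤ) → ℝ := fun S q =>
    ∑ p ∈ S with p.1 - p.2 = q, g p with hv
  have hv0 : ∀ S q, 0 ≤ v S q := fun S q => Finset.sum_nonneg fun p _ => hg p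
  have hvF : ∀ S ⊆ P, ∑ q ∈ Q, potentialCoeff w q * v S q = ∑ r ∈ S, F r := by
    intro S hS
    rw [← Finset.sum_fiberwise_of_maps_to (fun p hp => hQ p (hS hp)) F]
    refine Finset.sum_congr rfl fun q _ => ?_
    rw [hv, Finset.mul_sum]
    refine Finset.sum_congr rfl fun p hp => ?_
    rw [hF, ← (Finset.mem_filter.mp hp).2]
  have hdiff : truncInteraction κ w K - truncInteraction κ w K' =
      ∑ q ∈ Q, ((potentialCoeff w q / 2 : ℝ) : ℂ) • fun ω =>
        ((‖A q ω‖ ^ 2 : ℝ) : ℂ) - ((‖A' q ω‖ ^ 2 : ℝ) : ℂ) := by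
    funext ω
    rw [Pi.sub_apply, truncInteraction_eq_sum κ hpos hw K ω hQ,
      truncInteraction_eq_sum κ hpos hw K' ω fun p hp => hQ p (hPP hp), ← Finset.sum_sub_distrib,
      Finset.sum_apply]
    refine Finset.sum_congr rfl fun q _ => ?_
    rw [Pi.smul_apply, smul_eq_mul, mul_sub]
  have hsub : ∀ q, (fun ω => A q ω - A' q ω) = densityMode κ (P \ P') q := fun q => by
    funext ω
    have hsd : {p ∈ P \ P' | p.1 - p.2 = q} =
        {p ∈ P | p.1 - p.2 = q} \ {p ∈ P' | p.1 - p.2 = q} := by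
      ext p
      simp only [Finset.mem_filter, Finset.mem_sdiff]
      tauto
    simp only [densityMode, A, A']
    rw [hsd, Finset.sum_sdiff_eq_sub (Finset.filter_subset_filter _ hPP)]
  have hmeas : ∀ (S : Finset ((Fin d → ℤ) × (Fin d → ℤ))) q,
      AEStronglyMeasurable (densityMode κ S q) (freeFieldMeasure d) := fun S q =>
    (hasAllMoments_densityMode κ S q).aestronglyMeasurable
  have hn1 : (1 : ℝ≥0∞) ≤ n := by exact_mod_cast Nat.one_le_iff_ne_zero.mpr hn
  have hterm : ∀ q, eLpNorm (((potentialCoeff w q / 2 : ℝ) : ℂ) • fun ω =>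
      ((‖A q ω‖ ^ 2 : ℝ) : ℂ) - ((‖A' q ω‖ ^ 2 : ℝ) : ℂ)) n (freeFieldMeasure d) ≤
      ENNReal.ofReal (C ^ 2 * (√(potentialCoeff w q * v (P \ P') q) *
        √(potentialCoeff w q * v P q))) := by
    intro q
    have hle : v P' q ≤ v P q := Finset.sum_le_sum_of_subset_of_nonneg
      (Finset.filter_subset_filter _ hPP) fun p _ _ => hg p
    rw [eLpNorm_const_smul]
    calc ‖((potentialCoeff w q / 2 : ℝ) : ℂ)‖ₑ * eLpNorm (fun ω =>
          ((‖A q ω‖ ^ 2 : ℝ) : ℂ) - ((‖A' q ω‖ ^ 2 : ℝ) : ℂ)) n (freeFieldMeasure d)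
        ≤ ENNReal.ofReal (potentialCoeff w q / 2) *
          (ENNReal.ofReal (C * √(v (P \ P') q)) *
            (ENNReal.ofReal (C * √(v P q)) + ENNReal.ofReal (C * √(v P q)))) := by
          refine mul_le_mul' (le_of_eq ?_)
            ((eLpNorm_norm_sq_sub_norm_sq_le (hmeas P q) (hmeas P' q) hn).trans ?_)
          · rw [← ofReal_norm, Complex.norm_real,
              Real.norm_of_nonneg (div_nonneg (hβ q) zero_le_two)]
          · rw [hsub q]
            refine mul_le_mul' (hmode _ q) (add_le_add (hmode P q) ((hmode P' q).trans ?_))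
            gcongr
      _ = ENNReal.ofReal (potentialCoeff w q / 2 * ((C * √(v (P \ P') q)) *
            (C * √(v P q) + C * √(v P q)))) := by
          rw [ENNReal.ofReal_mul (div_nonneg (hβ q) zero_le_two),
            ENNReal.ofReal_mul (p := C * _) (by positivity),
            ENNReal.ofReal_add (by positivity) (by positivity)]
      _ = _ := by
          rw [Real.sqrt_mul (hβ q), Real.sqrt_mul (hβ q)]
          congr 1
          linear_combination (-(C ^ 2 * √(v (P \ P') q) * √(v P q))) * Real.mul_self_sqrt (hβ q)
  rw [hdiff]
  calc eLpNorm (∑ q ∈ Q, ((potentialCoeff w q / 2 : ℝ) : ℂ) • fun ω =>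
        ((‖A q ω‖ ^ 2 : ℝ) : ℂ) - ((‖A' q ω‖ ^ 2 : ℝ) : ℂ)) n (freeFieldMeasure d)
      ≤ ∑ q ∈ Q, ENNReal.ofReal (C ^ 2 * (√(potentialCoeff w q * v (P \ P') q) *
          √(potentialCoeff w q * v P q))) := by
        refine (eLpNorm_sum_le (fun q _ => ?_) hn1).trans (Finset.sum_le_sum fun q _ => hterm q)
        exact ((((hasAllMoments_densityMode κ P q).norm.pow 2).ofReal.sub
          (((hasAllMoments_densityMode κ P' q).norm.pow 2).ofReal))).aestronglyMeasurable.const_smul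
          _
    _ = ENNReal.ofReal (C ^ 2 * ∑ q ∈ Q, √(potentialCoeff w q * v (P \ P') q) *
          √(potentialCoeff w q * v P q)) := by
        rw [← ENNReal.ofReal_sum_of_nonneg fun q _ => by positivity, Finset.mul_sum]
    _ ≤ ENNReal.ofReal (C ^ 2 * (√(∑ r ∈ P \ P', F r) * √(∑' r, F r))) := by
        refine ENNReal.ofReal_le_ofReal (mul_le_mul_of_nonneg_left ?_ (sq_nonneg C))
        refine (Real.sum_sqrt_mul_sqrt_le Q (fun q => mul_nonneg (hβ q) (hv0 _ q))
          (fun q => mul_nonneg (hβ q) (hv0 _ q))).trans ?_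
        rw [hvF _ Finset.sdiff_subset, hvF _ subset_rfl]
        gcongr
        exact hsum.sum_le_tsum _ fun r _ => hF0 r
    _ = _ := by congr 1; ring

theorem exists_subset_freqBall_product (s : Finset ((Fin d → ℤ) × (Fin d → ℤ))) :
    ∃ N, s ⊆ freqBall d N ×ˢ freqBall d N := by
  obtain ⟨N, hN⟩ := exists_nat_ge
    (∑ p ∈ s, (√(freqNormSq p.1) + √(freqNormSq p.2)))
  refine ⟨N, fun p hp => ?_⟩
  have h := (Finset.single_le_sum (f := fun p : (Fin d → ℤ) × (Fin d → ℤ) =>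
    √(freqNormSq p.1) + √(freqNormSq p.2)) (fun _ _ => by positivity) hp).trans hN
  have h1 := Real.sqrt_nonneg (freqNormSq p.1)
  have h2 := Real.sqrt_nonneg (freqNormSq p.2)
  exact Finset.mem_product.mpr ⟨mem_freqBall.mpr (by linarith), mem_freqBall.mpr (by linarith)⟩

theorem truncInteraction_cauchy {κ : ℝ} (hκ : 0 < κ) {w : Torus d → ℂ}
    (hpos : IsPositiveType w) (hw : Integrable w (torusMeasure d))
    (hsum : Summable fun r : (Fin d → ℤ) × (Fin d → ℤ) =>
      potentialCoeff w (r.1 - r.2) * ((eigenvalue κ r.1)⁻¹ * (eigenvalue κ r.2)⁻¹))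
    {m : ℝ≥0∞} (hm : m ≠ ∞) {ε : ℝ≥0∞} (hε : 0 < ε) :
    ∃ N, ∀ K ≥ N, ∀ K' ≥ N,
      eLpNorm (truncInteraction κ w K - truncInteraction κ w K') m (freeFieldMeasure d) < ε := by
  obtain ⟨n, hn⟩ := ENNReal.exists_nat_gt hm
  have hn0 : n ≠ 0 := by
    rintro rfl
    simp at hn
  obtain ⟨C, hC, hbound⟩ := exists_eLpNorm_truncInteraction_sub_le hκ hpos hw hsum hn0
  obtain ⟨δ, hδ0, hδε⟩ := ENNReal.lt_iff_exists_nnreal_btwn.mp hε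
  have hδ : (0 : ℝ) < δ := by exact_mod_cast hδ0
  obtain ⟨s, hs⟩ := summable_iff_vanishing_norm.mp hsum ((δ / (C + 1)) ^ 2) (by positivity)
  obtain ⟨N, hN⟩ := exists_subset_freqBall_product s
  have key : ∀ K K' : ℕ, N ≤ K' → K' ≤ K →
      eLpNorm (truncInteraction κ w K - truncInteraction κ w K') m (freeFieldMeasure d) < ε := by
    intro K K' hK' hK
    have hmono := Finset.product_subset_product (freqBall_mono d hK') (freqBall_mono d hK')
    have hdisj : Disjoint ((freqBall d K ×ˢ freqBall d K) \ (freqBall d K' ×ˢ freqBall d K')) s :=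
      Finset.sdiff_disjoint.mono_right (hN.trans hmono)
    have htail := (le_abs_self _).trans_lt (hs _ hdisj)
    refine (eLpNorm_le_eLpNorm_of_exponent_le hn.le
      ((hasAllMoments_truncInteraction κ hpos hw K).aestronglyMeasurable.sub
        (hasAllMoments_truncInteraction κ hpos hw K').aestronglyMeasurable)).trans_lt ?_
    refine ((hbound K K' hK).trans ?_).trans_lt hδε
    rw [← ENNReal.ofReal_coe_nnreal]
    refine ENNReal.ofReal_le_ofReal ?_
    calc C * √_ ≤ C * (δ / (C + 1)) := by
          gcongr
          exact Real.sqrt_le_iff.mpr ⟨by positivity, htail.le⟩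
      _ ≤ δ := by
          rw [mul_div_assoc', div_le_iff₀ (by positivity)]
          nlinarith
  refine ⟨N, fun K hK K' hK' => ?_⟩
  rcases le_total K' K with h | h
  · exact key K K' hK' h
  · rw [eLpNorm_sub_comm]
    exact key K' K hK h

section Limits

variable {Ω : Type*} [MeasurableSpace Ω] {μ : Measure Ω}

theorem ae_eq_of_tendsto_eLpNorm [IsProbabilityMeasure μ] {f : ℕ → Ω → ℂ} {g h : Ω → ℂ}
    {p q : ℝ≥0∞} (hp : 1 ≤ p) (hq : 1 ≤ q) (hf : ∀ n, AEStronglyMeasurable (f n) μ)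
    (hg : AEStronglyMeasurable g μ) (hh : AEStronglyMeasurable h μ)
    (hfg : Tendsto (fun n => eLpNorm (f n - g) p μ) atTop (𝓝 0))
    (hfh : Tendsto (fun n => eLpNorm (f n - h) q μ) atTop (𝓝 0)) : g =ᵐ[μ] h :=
  tendstoInMeasure_ae_unique
    (tendstoInMeasure_of_tendsto_eLpNorm (zero_lt_one.trans_le hp).ne' hf hg hfg)
    (tendstoInMeasure_of_tendsto_eLpNorm (zero_lt_one.trans_le hq).ne' hf hh hfh)

theorem exists_tendsto_eLpNorm_of_cauchy {f : ℕ → Ω → ℂ} {p : ℝ≥0∞} (hp : 1 ≤ p)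
    (hf : ∀ n, MemLp (f n) p μ)
    (hc : ∀ ε > 0, ∃ N, ∀ n ≥ N, ∀ m ≥ N, eLpNorm (f n - f m) p μ < ε) :
    ∃ g, MemLp g p μ ∧ Tendsto (fun n => eLpNorm (f n - g) p μ) atTop (𝓝 0) := by
  have : Fact (1 ≤ p) := ⟨hp⟩
  have hcs : CauchySeq fun n => (hf n).toLp (f n) := by
    rw [EMetric.cauchySeq_iff]
    intro ε hε
    obtain ⟨N, hN⟩ := hc ε hε
    refine ⟨N, fun n hn m hm => ?_⟩
    rw [Lp.edist_toLp_toLp]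
    exact hN n hn m hm
  obtain ⟨g, hg⟩ := cauchySeq_tendsto_of_complete hcs
  refine ⟨g, Lp.memLp g, ?_⟩
  rw [← Lp.tendsto_Lp_iff_tendsto_eLpNorm'' f hf g (Lp.memLp g)]
  simpa using hg

end Limits

end

end WickGibbs

open WickGibbs in
theorem lemma1p2 {d : ℕ} (hd : d = 2 ∨ d = 3) {κ : ℝ} (hκ : 0 < κ) (w : Torus d → ℂ)
    (hw : IsAdmissible w ∨ IsEndpointAdmissible w) :
    -- `W_{[K]}` is a Cauchy sequence in `L^m(μ)` for every `1 ≤ m < ∞`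
    (∀ m : ℝ≥0∞, 1 ≤ m → m ≠ ∞ →
      (∀ K, MemLp (truncInteraction κ w K) m (freeFieldMeasure d)) ∧
      ∀ ε > 0, ∃ N, ∀ K ≥ N, ∀ K' ≥ N,
        eLpNorm (truncInteraction κ w K - truncInteraction κ w K') m (freeFieldMeasure d) < ε) ∧
    -- and there is a limit `W`, the same for all `m`, and unique almost everywhere
    ∃ W : ((Fin d → ℤ) → ℂ) → ℂ,
      (∀ m : ℝ≥0∞, 1 ≤ m → m ≠ ∞ →
        MemLp W m (freeFieldMeasure d) ∧
        Tendsto (fun K => eLpNorm (truncInteraction κ w K - W) m (freeFieldMeasure d))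
          atTop (𝓝 0)) ∧
      ∀ W' : ((Fin d → ℤ) → ℂ) → ℂ,
        (∃ m : ℝ≥0∞, 1 ≤ m ∧ m ≠ ∞ ∧ MemLp W' m (freeFieldMeasure d) ∧
          Tendsto (fun K => eLpNorm (truncInteraction κ w K - W') m (freeFieldMeasure d))
            atTop (𝓝 0)) →
        W' =ᵐ[freeFieldMeasure d] W := by
  obtain ⟨hpos, hint, hsum⟩ := summable_potentialCoeff hd hκ hw
  have hmom := hasAllMoments_truncInteraction κ hpos hint
  have hcauchy : ∀ m : ℝ≥0∞, m ≠ ∞ → ∀ ε > 0, ∃ N, ∀ K ≥ N, ∀ K' ≥ N,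
      eLpNorm (truncInteraction κ w K - truncInteraction κ w K') m (freeFieldMeasure d) < ε :=
    fun m hm ε hε => truncInteraction_cauchy hκ hpos hint hsum hm hε
  have hmeas := fun K => (hmom K).aestronglyMeasurable
  refine ⟨fun m _ hm => ⟨fun K => hmom K m hm, hcauchy m hm⟩, ?_⟩
  have hlim := fun (m : ℝ≥0∞) (h1 : 1 ≤ m) (hm : m ≠ ∞) =>
    exists_tendsto_eLpNorm_of_cauchy h1 (fun K => hmom K m hm) (hcauchy m hm)
  obtain ⟨W, hW, hWlim⟩ := hlim 1 le_rfl ENNReal.one_ne_top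
  refine ⟨W, fun m h1 hm => ?_, fun W' ⟨m, h1, hm, hW', hlim'⟩ => ?_⟩
  · obtain ⟨g, hg, hglim⟩ := hlim m h1 hm
    -- the limit in `L^m` agrees with the limit in `L^1`
    have hgW : g =ᵐ[freeFieldMeasure d] W := ae_eq_of_tendsto_eLpNorm h1 le_rfl hmeas
      hg.aestronglyMeasurable hW.aestronglyMeasurable hglim hWlim
    refine ⟨hg.ae_eq hgW, hglim.congr fun K => eLpNorm_congr_ae ?_⟩
    filter_upwards [hgW] with ω hω
    rw [Pi.sub_apply, Pi.sub_apply, hω]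
  · exact ae_eq_of_tendsto_eLpNorm h1 le_rfl hmeas hW'.aestronglyMeasurable
      hW.aestronglyMeasurable hlim' hWlim
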